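/- For a prime $p$, a Dirichlet character $\chi$ modulo $p$ and real $x>0$, let $\eta_\chi=1$ if $\chi$ is odd (that is, $\chi(-1)=-1$) and $\eta_\chi=0$ otherwise, and let $$\vartheta_p(x,\chi)=\sum_{n=1}^{\infty}\chi(n)\,n^{\eta_\chi}e^{-\pi n^2x/p}$$ be the theta function of $\chi$. For an integer $k\ge 1$ define the moments $$T_{2k}^+(p)=\sum_{\substack{\chi \bmod p\\ \chi(-1)=1,\ \chi\ne\chi_0}}|\vartheta_p(1,\chi)|^{2k},\qquad S_{2k}^-(p)=\sum_{\substack{\chi \bmod p\\ \chi(-1)=-1}}|\vartheta_p(1,\chi)|^{2k},$$ where $\chi_0$ is the principal character modulo $p$. **Theorem.** For every integer $k\ge 1$ there is a constant $c>0$, depending only on $k$, such that $$T_{2k}^+(p)\ge c\,p^{1+k/2}(\log p)^{(k-1)^2}\quad\text{for every prime } p\ge 5,$$ $$S_{2k}^-(p)\ge c\,p^{1+3k/2}(\log p)^{(k-1)^2}\quad\text{for every prime } p\ge 3.$$ -/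

import Mathlib

noncomputable section

open Classical in
/-- The parity of `χ`: `1` if `χ` is odd, and `0` otherwise. -/
def thetaParity {p : ℕ} (χ : DirichletCharacter ℂ p) : ℕ :=
  if χ.Odd then 1 else 0

/-- The series `∑_{n ≥ 1} χ(n) n^η exp(-π n² x / p)`, with its summation index `n` shifted by one. -/
def thetaSeries (p η : ℕ) (x : ℝ) (χ : DirichletCharacter ℂ p) : ℂ :=
  ∑' m : ℕ, χ ((m + 1 : ℕ) : ZMod p) * (((m + 1 : ℕ) : ℝ) ^ η : ℝ) *
    (Real.exp (-Real.pi * ((m + 1 : ℕ) : ℝ) ^ 2 * x / p) : ℝ)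

/-- The classical theta function `ϑ_p(x, χ)` of a Dirichlet character modulo `p`. -/
def dirichletTheta (p : ℕ) (x : ℝ) (χ : DirichletCharacter ℂ p) : ℂ :=
  thetaSeries p (thetaParity χ) x χ

open Classical in
/-- The moment `T_{2k}^+(p) = ∑ |ϑ_p(1, χ)|^{2k}` over the even nonprincipal characters modulo `p`. -/
def evenThetaMoment (k p : ℕ) : ℝ :=
  ∑ χ : DirichletCharacter ℂ p with χ.Even ∧ χ ≠ 1, ‖dirichletTheta p 1 χ‖ ^ (2 * k)

open Classical in
/-- The moment `S_{2k}^-(p) = ∑ |ϑ_p(1, χ)|^{2k}` over the odd characters modulo `p`. -/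
def oddThetaMoment (k p : ℕ) : ℝ :=
  ∑ χ : DirichletCharacter ℂ p with χ.Odd, ‖dirichletTheta p 1 χ‖ ^ (2 * k)

/-- The series that defines the theta function converges absolutely, so that the
`tsum` above is its actual sum. -/
theorem summable_thetaSeries (p η : ℕ) [NeZero p] {x : ℝ} (hx : 0 < x)
    (χ : DirichletCharacter ℂ p) :
    Summable fun m : ℕ => χ ((m + 1 : ℕ) : ZMod p) * (((m + 1 : ℕ) : ℝ) ^ η : ℝ) *
      (Real.exp (-Real.pi * ((m + 1 : ℕ) : ℝ) ^ 2 * x / p) : ℝ) := by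
  have hp : (0 : ℝ) < p := by exact_mod_cast Nat.pos_of_ne_zero (NeZero.ne p)
  have hc : 0 < Real.pi * x / p := by positivity
  have h1 : Summable fun n : ℕ => (n : ℝ) ^ η * Real.exp (-(Real.pi * x / p) * n) :=
    Real.summable_pow_mul_exp_neg_nat_mul η hc
  refine Summable.of_norm_bounded ((summable_nat_add_iff 1).2 h1) fun m => ?_
  rw [norm_mul, norm_mul, Complex.norm_real, Complex.norm_real, Real.norm_of_nonneg (by positivity),
    Real.norm_of_nonneg (by positivity)]
  have h2 : (1 : ℝ) ≤ ((m + 1 : ℕ) : ℝ) := by push_cast; linarith [Nat.cast_nonneg (α := ℝ) m]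
  have h3 : Real.exp (-Real.pi * ((m + 1 : ℕ) : ℝ) ^ 2 * x / p) ≤
      Real.exp (-(Real.pi * x / p) * ((m + 1 : ℕ) : ℝ)) := by
    apply Real.exp_le_exp.2
    have : -Real.pi * ((m + 1 : ℕ) : ℝ) ^ 2 * x / p =
      -(Real.pi * x / p) * ((m + 1 : ℕ) : ℝ) ^ 2 := by ring
    rw [this, neg_mul, neg_mul, neg_le_neg_iff]
    exact mul_le_mul_of_nonneg_left (by nlinarith) hc.le
  calc _ ≤ 1 * ((m + 1 : ℕ) : ℝ) ^ η * Real.exp (-(Real.pi * x / p) * ((m + 1 : ℕ) : ℝ)) := by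
        gcongr
        exact χ.norm_le_one _
    _ = _ := by rw [one_mul]

end

/-!
Put `k = n + 1`, `N = ⌊√p⌋`, `L = log p`, and let `y` be a small power of `p`. The theta function of
`χ` behaves like a weighted character sum of length `N`. It is tested against
`A(χ) ^ n * conj (H χ)`, where `A` is the sum of `χ` over the integers up to `y`, and `H` is the sum
of `h(v) χ(v)` over `v ≤ X = N * y ^ n`; here `h = k ^ Ω` on the residue class of `1` modulo a large
fixed factorial `Q`, and `h = 0` elsewhere. Hölder's inequality (`sum_mul_pow_mul_pow_le`) bounds the
`2k`-th power of the mixed moment `∑ ϑ(χ) A(χ) ^ n conj (H χ)` by the product of the moment to be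
estimated, the `n`-th power of `∑ |A| ^ (2k)`, and the `k`-th power of `∑ |H| ^ 2`.

* Mixed moment. By orthogonality the solutions of `m * a₁ ⋯ aₙ = v` contribute, and since `h` is
  supermultiplicative they give at least `p * ∑ h(m) * (∑ h(a)) ^ n`, up to a constant. The mean value
  of `h` has order at least `L ^ n` (`exists_sum_roughWeight_ge`), so this is of order at least
  `p * X * L ^ (n * k)`, with a further factor `N` for odd characters (`main_term_le_tsum`). For even
  characters the other solutions of the congruences are nonnegative, and the principal character is
  of smaller order. For odd characters the solutions of `m * a₁ ⋯ aₙ = -v` modulo `p` need such large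
  `m` that they are negligible (`tsum_odd_error_le`).
* `∑ |H| ^ 2` is at most of order `p * X * L ^ (k ^ 2 - 1)` (`sum_coprime_pow_cardFactors_le`). The
  class of `1` modulo `Q` keeps out small primes, at which `k ^ (2 Ω)` is too large.
* `∑ |A| ^ (2k)` is at most `p` times the number of solutions of `a₁ ⋯ a_k = b₁ ⋯ b_k`, which is at
  most of order `y ^ k * L ^ (n ^ 2)` (`multiplicativeEnergy_le`). Each solution has a refinement, a
  matrix of positive integers with row products `aᵢ` and column products `bⱼ`. Given the
  off-diagonal entries, the diagonal entry `i` has at most `y / max(rᵢ, cᵢ)` values, where `rᵢ` and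
  `cᵢ` are the products of the off-diagonal entries of row and column `i`. Up to the constraints
  `rᵢ ≈ cᵢ`, each off-diagonal entry has a harmonic weight and costs a factor `L`; the `n` independent
  constraints remove `n` of the `n * k` logarithms.

Combining the three bounds gives the theorem for all large `p`. For each of the remaining primes the
moment is positive, since otherwise orthogonality would equate the total weights of the theta series
in two residue classes, whose leading terms differ too much (`evenThetaMoment_pos`,
`oddThetaMoment_pos`).
-/

open Finset
open scoped ArithmeticFunction.Omega ComplexConjugate

/-! ### Divisor sums and mean values of powers of `Ω` -/

theorem sum_divisors_prime_mul_le {q m : ℕ} (hq : q.Prime) (hm : m ≠ 0) (j : ℕ) :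
    ∑ d ∈ (q * m).divisors, j ^ Ω d ≤ (j + 1) * ∑ d ∈ m.divisors, j ^ Ω d := by
  have hsub : (q * m).divisors ⊆ m.divisors ∪ m.divisors.image (q * ·) := by
    intro d hd
    obtain ⟨d₁, d₂, h₁, h₂, rfl⟩ := exists_dvd_and_dvd_of_dvd_mul (Nat.dvd_of_mem_divisors hd)
    rcases (Nat.dvd_prime hq).1 h₁ with rfl | rfl
    · simp [h₂, hm]
    · exact mem_union_right _ (mem_image_of_mem _ (by simp [h₂, hm]))
  calc _ ≤ ∑ d ∈ m.divisors ∪ m.divisors.image (q * ·), j ^ Ω d := sum_le_sum_of_subset hsub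
    _ ≤ ∑ d ∈ m.divisors, j ^ Ω d + ∑ d ∈ m.divisors.image (q * ·), j ^ Ω d := by
        rw [← sum_union_inter]; exact Nat.le_add_right _ _
    _ = ∑ d ∈ m.divisors, j ^ Ω d + ∑ d ∈ m.divisors, j * j ^ Ω d := by
        rw [sum_image fun a _ b _ h => Nat.eq_of_mul_eq_mul_left hq.pos h]
        congr 1
        refine sum_congr rfl fun d hd => ?_
        rw [ArithmeticFunction.cardFactors_mul hq.ne_zero (Nat.pos_of_mem_divisors hd).ne',
          ArithmeticFunction.cardFactors_apply_prime hq, pow_add, pow_one]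
    _ = _ := by rw [← mul_sum]; ring

/-- Summing the completely multiplicative function `j ^ Ω` over divisors gives at most
`(j + 1) ^ Ω`. -/
theorem sum_divisors_pow_cardFactors_le (j : ℕ) {n : ℕ} (hn : n ≠ 0) :
    ∑ d ∈ n.divisors, j ^ Ω d ≤ (j + 1) ^ Ω n := by
  induction n using induction_on_primes with
  | zero => exact absurd rfl hn
  | one => simp
  | prime_mul q a hq ih =>
    have ha : a ≠ 0 := right_ne_zero_of_mul hn
    rw [ArithmeticFunction.cardFactors_mul hq.ne_zero ha,
      ArithmeticFunction.cardFactors_apply_prime hq, pow_add, pow_one]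
    exact (sum_divisors_prime_mul_le hq ha j).trans (Nat.mul_le_mul_left _ (ih ha))

theorem pow_cardFactors_le_sum_divisors (j : ℕ) {n : ℕ} (hn : Squarefree n) :
    (j + 1) ^ Ω n ≤ ∑ d ∈ n.divisors, j ^ Ω d := by
  induction n using induction_on_primes with
  | zero => exact absurd hn not_squarefree_zero
  | one => simp
  | prime_mul q a hq ih =>
    obtain ⟨hco, -, hsq⟩ := Nat.squarefree_mul_iff.1 hn
    have ha : a ≠ 0 := hsq.ne_zero
    have hqa : ¬ q ∣ a := (Nat.Prime.coprime_iff_not_dvd hq).1 hco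
    have hdis : Disjoint a.divisors (a.divisors.image (q * ·)) := by
      rw [disjoint_left]
      intro d hd hd'
      obtain ⟨e, -, rfl⟩ := mem_image.1 hd'
      exact hqa ((dvd_mul_right q e).trans (Nat.dvd_of_mem_divisors hd))
    have hsub : a.divisors ∪ a.divisors.image (q * ·) ⊆ (q * a).divisors := by
      intro d hd
      rw [Nat.mem_divisors]
      refine ⟨?_, mul_ne_zero hq.ne_zero ha⟩
      rcases mem_union.1 hd with h | h
      · exact (Nat.dvd_of_mem_divisors h).mul_left q
      · obtain ⟨e, he, rfl⟩ := mem_image.1 h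
        exact Nat.mul_dvd_mul_left q (Nat.dvd_of_mem_divisors he)
    rw [ArithmeticFunction.cardFactors_mul hq.ne_zero ha,
      ArithmeticFunction.cardFactors_apply_prime hq, pow_add, pow_one]
    calc _ ≤ (j + 1) * ∑ d ∈ a.divisors, j ^ Ω d := Nat.mul_le_mul_left _ (ih hsq)
      _ = ∑ d ∈ a.divisors, j ^ Ω d + ∑ d ∈ a.divisors, j * j ^ Ω d := by
          rw [← mul_sum]; ring
      _ = ∑ d ∈ a.divisors, j ^ Ω d + ∑ d ∈ a.divisors.image (q * ·), j ^ Ω d := by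
          rw [sum_image fun a _ b _ h => Nat.eq_of_mul_eq_mul_left hq.pos h]
          congr 1
          refine sum_congr rfl fun d hd => ?_
          rw [ArithmeticFunction.cardFactors_mul hq.ne_zero (Nat.pos_of_mem_divisors hd).ne',
            ArithmeticFunction.cardFactors_apply_prime hq, pow_add, pow_one]
      _ ≤ _ := by rw [← sum_union hdis]; exact sum_le_sum_of_subset hsub

theorem sum_inv_Icc_le (y : ℕ) : ∑ x ∈ Icc 1 y, (x : ℝ)⁻¹ ≤ 1 + Real.log y := by
  have h := harmonic_le_one_add_log y
  rw [harmonic_eq_sum_Icc] at h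
  push_cast at h
  exact h

theorem sum_squarefree_succ_pow_cardFactors_le (K X : ℕ) :
    ∑ a ∈ Icc 1 X with Squarefree a, (K + 1) ^ Ω a ≤
      ∑ x ∈ Icc 1 X, ∑ d ∈ Icc 1 (X / x) with Squarefree d, K ^ Ω d := by
  rw [sum_sigma']
  set P := (Icc 1 X).sigma fun x => {d ∈ Icc 1 (X / x) | Squarefree d} with hP
  have hmem : ∀ q ∈ P, q.1 * q.2 ∈ Icc 1 X := by
    intro q hq
    simp only [hP, mem_sigma, mem_filter, mem_Icc] at hq ⊢
    exact ⟨Nat.mul_pos hq.1.1 hq.2.1.1, by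
      rw [mul_comm]; exact (Nat.le_div_iff_mul_le hq.1.1).1 hq.2.1.2⟩
  rw [← sum_fiberwise_of_maps_to hmem]
  refine (sum_le_sum fun a ha => ?_).trans
    (sum_le_sum_of_subset (filter_subset (fun a => Squarefree a) (Icc 1 X)))
  obtain ⟨ha, hsq⟩ := mem_filter.1 ha
  refine (pow_cardFactors_le_sum_divisors K hsq).trans ?_
  rw [← sum_image (f := fun q : (_ : ℕ) × ℕ => K ^ Ω q.2) (g := fun d => ⟨a / d, d⟩)
    (fun d _ e _ h => by simpa using (congrArg Sigma.snd h))]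
  refine sum_le_sum_of_subset ?_
  intro q hq
  obtain ⟨d, hd, rfl⟩ := mem_image.1 hq
  have hda := Nat.dvd_of_mem_divisors hd
  have hd0 := Nat.pos_of_mem_divisors hd
  rw [mem_Icc] at ha
  have hq0 : 0 < a / d := Nat.div_pos (Nat.le_of_dvd ha.1 hda) hd0
  simp only [hP, mem_sigma, mem_filter, mem_Icc]
  refine ⟨⟨⟨hq0, (Nat.div_le_self _ _).trans ha.2⟩, ⟨hd0, ?_⟩, hsq.squarefree_of_dvd hda⟩,
    Nat.div_mul_cancel hda⟩
  rw [Nat.le_div_iff_mul_le hq0, Nat.mul_div_cancel' hda]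
  exact ha.2

/-- The mean value over squarefree integers of the function `(K + 1) ^ ω`. -/
theorem sum_squarefree_pow_cardFactors_le (K X : ℕ) :
    ((∑ a ∈ Icc 1 X with Squarefree a, (K + 1) ^ Ω a : ℕ) : ℝ) ≤
      X * (1 + Real.log X) ^ K := by
  induction K generalizing X with
  | zero =>
    simp only [zero_add, one_pow, sum_const, smul_eq_mul, mul_one, pow_zero]
    exact_mod_cast (card_filter_le _ _).trans (by simp)
  | succ K ih =>
    calc ((∑ a ∈ Icc 1 X with Squarefree a, (K + 1 + 1) ^ Ω a : ℕ) : ℝ)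
        ≤ ((∑ x ∈ Icc 1 X, ∑ d ∈ Icc 1 (X / x) with Squarefree d, (K + 1) ^ Ω d : ℕ) : ℝ) := by
          exact_mod_cast sum_squarefree_succ_pow_cardFactors_le (K + 1) X
      _ = ∑ x ∈ Icc 1 X, ((∑ d ∈ Icc 1 (X / x) with Squarefree d, (K + 1) ^ Ω d : ℕ) : ℝ) := by
          push_cast; rfl
      _ ≤ ∑ x ∈ Icc 1 X, X * (1 + Real.log X) ^ K * (x : ℝ)⁻¹ := by
          refine sum_le_sum fun x hx => (ih _).trans ?_
          rw [mem_Icc] at hx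
          have h1 : ((X / x : ℕ) : ℝ) ≤ X / x := Nat.cast_div_le
          have h2 : 1 ≤ X / x := Nat.div_pos hx.2 hx.1
          have h3 : (1 : ℝ) ≤ ((X / x : ℕ) : ℝ) := by exact_mod_cast h2
          have h4 : Real.log ((X / x : ℕ) : ℝ) ≤ Real.log X :=
            Real.log_le_log (by linarith) (by exact_mod_cast Nat.div_le_self X x)
          have h5 := Real.log_nonneg h3
          calc _ ≤ (X / x : ℝ) * (1 + Real.log X) ^ K := by gcongr
            _ = _ := by rw [div_eq_mul_inv]; ring
      _ = X * (1 + Real.log X) ^ K * ∑ x ∈ Icc 1 X, (x : ℝ)⁻¹ := by rw [mul_sum]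
      _ ≤ X * (1 + Real.log X) ^ K * (1 + Real.log X) := by
          have := Real.log_natCast_nonneg X
          have := sum_inv_Icc_le X
          gcongr
      _ = _ := by rw [pow_succ]; ring

/-- If every prime factor of `b` exceeds `K`, then `K ^ Ω b ≤ b`. -/
theorem pow_cardFactors_le_of_coprime_factorial (K : ℕ) {b : ℕ} (hb : b ≠ 0)
    (hco : b.Coprime K.factorial) : K ^ Ω b ≤ b := by
  induction b using induction_on_primes with
  | zero => exact absurd rfl hb
  | one => simp
  | prime_mul q a hq ih =>
    have ha : a ≠ 0 := right_ne_zero_of_mul hb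
    rw [ArithmeticFunction.cardFactors_mul hq.ne_zero ha,
      ArithmeticFunction.cardFactors_apply_prime hq, pow_add, pow_one]
    refine Nat.mul_le_mul ?_ (ih ha (Nat.Coprime.coprime_mul_left hco))
    by_contra! hlt
    exact (Nat.Prime.coprime_iff_not_dvd hq).1 (Nat.Coprime.coprime_mul_right hco)
      ((Nat.Prime.dvd_factorial hq).2 hlt.le)

theorem sum_coprime_pow_cardFactors_le_sum (K Q X : ℕ) :
    ∑ v ∈ Icc 1 X with v.Coprime Q, K ^ Ω v ≤
      ∑ b ∈ Icc 1 X with b.Coprime Q,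
        K ^ (2 * Ω b) * ∑ a ∈ Icc 1 (X / b ^ 2) with Squarefree a, K ^ Ω a := by
  simp_rw [mul_sum]
  rw [sum_sigma']
  set P := ({b ∈ Icc 1 X | b.Coprime Q}).sigma
    fun b => {a ∈ Icc 1 (X / b ^ 2) | Squarefree a} with hP
  have hmem : ∀ q ∈ P, q.1 ^ 2 * q.2 ∈ Icc 1 X := by
    intro q hq
    simp only [hP, mem_sigma, mem_filter, mem_Icc] at hq ⊢
    have h0 : 0 < q.1 ^ 2 := pow_pos hq.1.1.1 2
    exact ⟨Nat.mul_pos h0 hq.2.1.1, by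
      rw [mul_comm]; exact (Nat.le_div_iff_mul_le h0).1 hq.2.1.2⟩
  rw [← sum_fiberwise_of_maps_to hmem]
  refine (sum_le_sum fun v hv => ?_).trans
    (sum_le_sum_of_subset (filter_subset (fun v => v.Coprime Q) (Icc 1 X)))
  obtain ⟨hv, hco⟩ := mem_filter.1 hv
  rw [mem_Icc] at hv
  obtain ⟨a, b, ha, hb, rfl, hsq⟩ := Nat.sq_mul_squarefree_of_pos hv.1
  have hb2 : 0 < b ^ 2 := pow_pos hb 2
  have hmem' : (⟨b, a⟩ : (_ : ℕ) × ℕ) ∈ {q ∈ P | q.1 ^ 2 * q.2 = b ^ 2 * a} := by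
    simp only [hP, mem_sigma, mem_filter, mem_Icc, and_true]
    refine ⟨⟨⟨hb, ?_⟩, ?_⟩, ⟨ha, ?_⟩, hsq⟩
    · calc b ≤ b * (b * a) := Nat.le_mul_of_pos_right b (Nat.mul_pos hb ha)
        _ = b ^ 2 * a := by ring
        _ ≤ X := hv.2
    · exact Nat.Coprime.coprime_dvd_left (Dvd.intro (b * a) (by ring)) hco
    · rw [Nat.le_div_iff_mul_le hb2, mul_comm]
      exact hv.2
  calc K ^ Ω (b ^ 2 * a) = K ^ (2 * Ω b) * K ^ Ω a := by
        rw [ArithmeticFunction.cardFactors_mul hb2.ne' ha.ne', ArithmeticFunction.cardFactors_pow,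
          pow_add]
    _ ≤ _ := single_le_sum (f := fun q : (_ : ℕ) × ℕ => K ^ (2 * Ω q.1) * K ^ Ω q.2)
        (fun _ _ => Nat.zero_le _) hmem'

/-- The mean value of `(K + 1) ^ Ω` over integers free of small prime factors has the order of
magnitude of the mean value of the `(K + 1)`-fold divisor function. Writing `v = b ^ 2 * a` with `a`
squarefree reduces to squarefree integers, because `(K + 1) ^ (2 * Ω b) ≤ b ^ (1 / 2)`. -/
theorem sum_coprime_pow_cardFactors_le (K X : ℕ) :
    ((∑ v ∈ Icc 1 X with v.Coprime ((K + 1) ^ 4).factorial, (K + 1) ^ Ω v : ℕ) : ℝ) ≤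
      (∑' n : ℕ, 1 / (n : ℝ) ^ (3 / 2 : ℝ)) * (X * (1 + Real.log X) ^ K) := by
  set Q := ((K + 1) ^ 4).factorial
  have hsum : Summable fun n : ℕ => 1 / (n : ℝ) ^ (3 / 2 : ℝ) :=
    Real.summable_one_div_nat_rpow.2 (by norm_num)
  have hlogX := Real.log_natCast_nonneg X
  calc ((∑ v ∈ Icc 1 X with v.Coprime Q, (K + 1) ^ Ω v : ℕ) : ℝ)
      ≤ ((∑ b ∈ Icc 1 X with b.Coprime Q, (K + 1) ^ (2 * Ω b) *
          ∑ a ∈ Icc 1 (X / b ^ 2) with Squarefree a, (K + 1) ^ Ω a : ℕ) : ℝ) := by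
        exact_mod_cast sum_coprime_pow_cardFactors_le_sum (K + 1) Q X
    _ = ∑ b ∈ Icc 1 X with b.Coprime Q, ((K + 1 : ℕ) : ℝ) ^ (2 * Ω b) *
          ((∑ a ∈ Icc 1 (X / b ^ 2) with Squarefree a, (K + 1) ^ Ω a : ℕ) : ℝ) := by
        push_cast; rfl
    _ ≤ ∑ b ∈ Icc 1 X with b.Coprime Q, 1 / (b : ℝ) ^ (3 / 2 : ℝ) *
          (X * (1 + Real.log X) ^ K) := by
        refine sum_le_sum fun b hb => ?_
        obtain ⟨hb, hco⟩ := mem_filter.1 hb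
        rw [mem_Icc] at hb
        have hb0 : (0 : ℝ) < b := by exact_mod_cast hb.1
        have h1 : ((K + 1 : ℕ) : ℝ) ^ (2 * Ω b) ≤ (b : ℝ) ^ (1 / 2 : ℝ) := by
          rw [← Real.sqrt_eq_rpow]
          refine Real.le_sqrt_of_sq_le ?_
          have := pow_cardFactors_le_of_coprime_factorial _ (Nat.pos_iff_ne_zero.1 hb.1) hco
          rw [← pow_mul] at this
          rw [← pow_mul, show 2 * Ω b * 2 = 4 * Ω b by ring]
          exact_mod_cast this
        have h2 : ((∑ a ∈ Icc 1 (X / b ^ 2) with Squarefree a, (K + 1) ^ Ω a : ℕ) : ℝ) ≤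
            X / (b : ℝ) ^ 2 * (1 + Real.log X) ^ K := by
          refine (sum_squarefree_pow_cardFactors_le K _).trans ?_
          have h3 : ((X / b ^ 2 : ℕ) : ℝ) ≤ X / (b : ℝ) ^ 2 := by
            exact_mod_cast (Nat.cast_div_le : ((X / b ^ 2 : ℕ) : ℝ) ≤ _)
          rcases Nat.eq_zero_or_pos (X / b ^ 2) with h4 | h4
          · rw [h4]
            simp only [Nat.cast_zero, zero_mul]
            positivity
          · have h5 : (1 : ℝ) ≤ ((X / b ^ 2 : ℕ) : ℝ) := by exact_mod_cast h4
            have h6 := Real.log_nonneg h5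
            have h7 : Real.log ((X / b ^ 2 : ℕ) : ℝ) ≤ Real.log X :=
              Real.log_le_log (by linarith) (by exact_mod_cast Nat.div_le_self X _)
            gcongr
        calc _ ≤ (b : ℝ) ^ (1 / 2 : ℝ) * (X / (b : ℝ) ^ 2 * (1 + Real.log X) ^ K) := by
              gcongr
          _ = (b : ℝ) ^ (1 / 2 : ℝ) / (b : ℝ) ^ 2 * (X * (1 + Real.log X) ^ K) := by ring
          _ = _ := by
              rw [← Real.rpow_natCast (b : ℝ) 2, ← Real.rpow_sub hb0,
                one_div ((b : ℝ) ^ (3 / 2 : ℝ)), ← Real.rpow_neg hb0.le]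
              norm_num
    _ = (∑ b ∈ Icc 1 X with b.Coprime Q, 1 / (b : ℝ) ^ (3 / 2 : ℝ)) *
          (X * (1 + Real.log X) ^ K) := by rw [sum_mul]
    _ ≤ _ := by
        gcongr
        exact hsum.sum_le_tsum _ fun n _ => by positivity

/-- The completely multiplicative function `k ^ Ω`, restricted to the residue class of `1`
modulo `Q`. -/
def roughWeight (k Q v : ℕ) : ℝ := if v ≡ 1 [MOD Q] then (k : ℝ) ^ Ω v else 0

theorem roughWeight_nonneg (k Q v : ℕ) : 0 ≤ roughWeight k Q v := by
  unfold roughWeight; split_ifs <;> positivity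

theorem roughWeight_mul_le (k Q : ℕ) {a b : ℕ} (ha : a ≠ 0) (hb : b ≠ 0) :
    roughWeight k Q a * roughWeight k Q b ≤ roughWeight k Q (a * b) := by
  by_cases h₁ : a ≡ 1 [MOD Q]
  · by_cases h₂ : b ≡ 1 [MOD Q]
    · rw [roughWeight, roughWeight, roughWeight, if_pos h₁, if_pos h₂,
        if_pos (by simpa using h₁.mul h₂), ArithmeticFunction.cardFactors_mul ha hb, pow_add]
    · simpa [roughWeight, h₂] using roughWeight_nonneg k Q (a * b)
  · simpa [roughWeight, h₁] using roughWeight_nonneg k Q (a * b)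

theorem coprime_of_modEq_one {v Q : ℕ} (h : v ≡ 1 [MOD Q]) : v.Coprime Q := by
  rw [Nat.coprime_iff_gcd_eq_one, h.gcd_eq, Nat.gcd_one_left]

theorem sum_roughWeight_sq_le {k : ℕ} (hk : 1 ≤ k) (X : ℕ) :
    ∑ v ∈ Icc 1 X, roughWeight k ((k ^ 2) ^ 4).factorial v ^ 2 ≤
      (∑' n : ℕ, 1 / (n : ℝ) ^ (3 / 2 : ℝ)) * (X * (1 + Real.log X) ^ (k ^ 2 - 1)) := by
  have hK : k ^ 2 - 1 + 1 = k ^ 2 := Nat.sub_add_cancel (Nat.one_le_pow _ _ hk)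
  have h := sum_coprime_pow_cardFactors_le (k ^ 2 - 1) X
  rw [hK] at h
  refine le_trans ?_ h
  push_cast
  rw [sum_filter]
  refine sum_le_sum fun v _ => ?_
  by_cases hv : v ≡ 1 [MOD ((k ^ 2) ^ 4).factorial]
  · rw [if_pos (coprime_of_modEq_one hv), roughWeight, if_pos hv, ← pow_mul, ← pow_mul, mul_comm]
  · rw [roughWeight, if_neg hv, zero_pow two_ne_zero]
    split_ifs <;> positivity

theorem roughWeight_le_sq {k : ℕ} (hk : 1 ≤ k) (Q v : ℕ) :
    roughWeight k Q v ≤ roughWeight k Q v ^ 2 := by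
  unfold roughWeight
  split_ifs
  · exact le_self_pow₀ (one_le_pow₀ (by exact_mod_cast hk)) two_ne_zero
  · simp

theorem sum_inv_modEq_ge {Q : ℕ} (hQ : 0 < Q) {Z : ℕ} (hZ : Q ≤ Z) :
    (1 / Q : ℝ) * Real.log (Z / Q) ≤ ∑ x ∈ Icc 1 Z with x ≡ 1 [MOD Q], (x : ℝ)⁻¹ := by
  have hQ' : (0 : ℝ) < Q := by exact_mod_cast hQ
  have hlt : Z < Q * (Z / Q + 1) := Nat.lt_mul_div_succ Z hQ
  have h1 : Real.log (Z / Q) ≤ ∑ i ∈ range (Z / Q), ((i : ℝ) + 1)⁻¹ := by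
    have h := log_add_one_le_harmonic (Z / Q)
    rw [harmonic] at h
    push_cast at h
    refine le_trans (Real.log_le_log ?_ ?_) h
    · have : (0 : ℝ) < Z := by exact_mod_cast hQ.trans_le hZ
      positivity
    · rw [div_le_iff₀ hQ', mul_comm]
      exact_mod_cast hlt.le
  calc (1 / Q : ℝ) * Real.log (Z / Q) ≤ (1 / Q : ℝ) * ∑ i ∈ range (Z / Q), ((i : ℝ) + 1)⁻¹ := by
        gcongr
    _ = ∑ i ∈ range (Z / Q), (1 / Q : ℝ) * ((i : ℝ) + 1)⁻¹ := by rw [mul_sum]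
    _ ≤ ∑ i ∈ range (Z / Q), ((1 + i * Q : ℕ) : ℝ)⁻¹ := by
        refine sum_le_sum fun i _ => ?_
        rw [one_div, ← mul_inv]
        have : (1 : ℝ) ≤ Q := by exact_mod_cast hQ
        refine inv_anti₀ (by positivity) ?_
        push_cast
        nlinarith
    _ = ∑ x ∈ (range (Z / Q)).image (fun i => 1 + i * Q), (x : ℝ)⁻¹ := by
        rw [sum_image]
        intro i _ j _ hij
        exact Nat.eq_of_mul_eq_mul_right hQ (Nat.add_left_cancel hij)
    _ ≤ _ := by
        refine sum_le_sum_of_subset_of_nonneg ?_ fun _ _ _ => by positivity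
        intro x hx
        obtain ⟨i, hi, rfl⟩ := mem_image.1 hx
        rw [mem_range] at hi
        simp only [mem_filter, mem_Icc]
        refine ⟨⟨Nat.le_add_right _ _, ?_⟩, ?_⟩
        · have h2 : (i + 1) * Q ≤ Z := (Nat.le_div_iff_mul_le hQ).1 hi
          nlinarith
        · simp [Nat.ModEq]

theorem card_dyadic_modEq_ge {Q : ℕ} (hQ : 0 < Q) {M : ℝ} (hM : 8 * Q ≤ M) :
    M / (4 * Q) ≤ ((#{a ∈ Icc 1 ⌊M⌋₊ | M / 2 < ((a : ℕ) : ℝ) ∧ a ≡ 1 [MOD Q]} : ℕ) : ℝ) := by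
  have hQ' : (1 : ℝ) ≤ Q := by exact_mod_cast hQ
  have hQ0 : (0 : ℝ) < Q := by linarith
  have hM0 : 0 ≤ M := by linarith
  set A := ⌊M / (2 * Q)⌋₊
  set B := ⌊(M - 1) / Q⌋₊
  have hA : (A : ℝ) ≤ M / (2 * Q) := Nat.floor_le (by positivity)
  have hB : (M - 1) / Q < B + 1 := Nat.lt_floor_add_one _
  have hsub : (Ioc A B).image (fun i => 1 + i * Q) ⊆
      {a ∈ Icc 1 ⌊M⌋₊ | M / 2 < ((a : ℕ) : ℝ) ∧ a ≡ 1 [MOD Q]} := by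
    intro a ha
    obtain ⟨i, hi, rfl⟩ := mem_image.1 ha
    rw [mem_Ioc] at hi
    have h1 : M / (2 * Q) < i := (Nat.floor_lt (by positivity)).1 hi.1
    have h2 : (i : ℝ) ≤ (M - 1) / Q :=
      (Nat.le_floor_iff (div_nonneg (by linarith) hQ0.le)).1 hi.2
    rw [div_lt_iff₀ (by positivity)] at h1
    rw [le_div_iff₀ hQ0] at h2
    simp only [mem_filter, mem_Icc]
    refine ⟨⟨Nat.le_add_right _ _, Nat.le_floor ?_⟩, ?_, by simp [Nat.ModEq]⟩
    · push_cast; linarith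
    · push_cast; linarith
  have hcard : (#((Ioc A B).image fun i => 1 + i * Q) : ℝ) = ((B - A : ℕ) : ℝ) := by
    rw [card_image_of_injective, Nat.card_Ioc]
    intro i j hij
    exact Nat.eq_of_mul_eq_mul_right hQ (Nat.add_left_cancel hij)
  have hle : (B : ℝ) - A ≤ ((B - A : ℕ) : ℝ) := by
    rw [sub_le_iff_le_add]
    exact_mod_cast (by omega : B ≤ B - A + A)
  have hmain : M / (4 * Q) ≤ (B : ℝ) - A := by
    have h3 : M / (2 * Q) = 2 * (M / (4 * Q)) := by field_simp; ring
    have h4 : (M - 1) / Q = 4 * (M / (4 * Q)) - 1 / Q := by field_simp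
    have h5 : 1 / (Q : ℝ) ≤ 1 := by rw [div_le_one hQ0]; exact hQ'
    have h6 : 2 ≤ M / (4 * Q) := by rw [le_div_iff₀ (by positivity)]; linarith
    linarith
  exact (hmain.trans hle).trans (hcard ▸ by exact_mod_cast card_le_card hsub)

/-- Summing the weight with parameter `n + 1` over the cofactors of small `x` is a lower bound for
the sum of the weight with parameter `n + 2`. -/
theorem sum_sum_roughWeight_le (n Q Z : ℕ) {M : ℝ} (hM : 0 ≤ M) :
    ∑ x ∈ Icc 1 Z with x ≡ 1 [MOD Q],
      ∑ d ∈ Icc 1 ⌊M / x⌋₊ with M / x / 2 < ((d : ℕ) : ℝ), roughWeight (n + 1) Q d ≤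
    ∑ a ∈ Icc 1 ⌊M⌋₊ with M / 2 < ((a : ℕ) : ℝ), roughWeight (n + 2) Q a := by
  rw [sum_sigma']
  set P := ({x ∈ Icc 1 Z | x ≡ 1 [MOD Q]}).sigma
    fun x => {d ∈ Icc 1 ⌊M / x⌋₊ | M / x / 2 < ((d : ℕ) : ℝ)} with hP
  have hmem : ∀ q ∈ P, q.1 * q.2 ∈ {a ∈ Icc 1 ⌊M⌋₊ | M / 2 < ((a : ℕ) : ℝ)} := by
    intro q hq
    simp only [hP, mem_sigma, mem_filter, mem_Icc] at hq ⊢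
    obtain ⟨⟨⟨hx1, -⟩, -⟩, ⟨hd1, hd2⟩, hd3⟩ := hq
    have hx0 : (0 : ℝ) < q.1 := by exact_mod_cast hx1
    have h1 : (q.2 : ℝ) ≤ M / q.1 := (Nat.le_floor_iff (by positivity)).1 hd2
    rw [le_div_iff₀ hx0] at h1
    rw [div_div, div_lt_iff₀ (by positivity)] at hd3
    refine ⟨⟨Nat.mul_pos hx1 hd1, Nat.le_floor ?_⟩, ?_⟩
    · push_cast; linarith
    · push_cast; linarith
  rw [← sum_fiberwise_of_maps_to hmem]
  refine sum_le_sum fun a ha => ?_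
  have ha0 : a ≠ 0 := by
    have := (mem_Icc.1 (mem_filter.1 ha).1).1
    omega
  have hfib : ∀ q ∈ {q ∈ P | q.1 * q.2 = a}, q.1 ≡ 1 [MOD Q] ∧ q.2 ∈ a.divisors := by
    intro q hq
    simp only [hP, mem_sigma, mem_filter] at hq
    exact ⟨hq.1.1.2, Nat.mem_divisors.2 ⟨Dvd.intro_left _ hq.2, ha0⟩⟩
  by_cases hmod : a ≡ 1 [MOD Q]
  · have hdiv : ((∑ d ∈ a.divisors, (n + 1) ^ Ω d : ℕ) : ℝ) ≤ roughWeight (n + 2) Q a := by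
      rw [roughWeight, if_pos hmod]
      exact_mod_cast sum_divisors_pow_cardFactors_le (n + 1) ha0
    refine le_trans ?_ hdiv
    push_cast
    calc ∑ q ∈ P with q.1 * q.2 = a, roughWeight (n + 1) Q q.2
        ≤ ∑ q ∈ P with q.1 * q.2 = a, ((n : ℝ) + 1) ^ Ω q.2 := by
          refine sum_le_sum fun q _ => ?_
          unfold roughWeight
          split_ifs
          · push_cast; exact le_rfl
          · positivity
      _ = ∑ d ∈ ({q ∈ P | q.1 * q.2 = a}).image Sigma.snd, ((n : ℝ) + 1) ^ Ω d := by
          rw [sum_image]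
          rintro ⟨x, d⟩ hq ⟨x', d'⟩ hq' h
          obtain rfl : d = d' := h
          have h1 := (mem_filter.1 hq).2
          have h2 := (mem_filter.1 hq').2
          have hd : d ≠ 0 := by
            rintro rfl
            exact ha0 (by simpa using h1.symm)
          obtain rfl : x = x' := Nat.eq_of_mul_eq_mul_right (Nat.pos_of_ne_zero hd)
            (h1.trans h2.symm)
          rfl
      _ ≤ _ := by
          refine sum_le_sum_of_subset_of_nonneg ?_ fun _ _ _ => by positivity
          intro d hd
          obtain ⟨q, hq, rfl⟩ := mem_image.1 hd
          exact (hfib q hq).2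
  · refine (sum_nonpos fun q hq => ?_).trans (roughWeight_nonneg _ _ _)
    rw [roughWeight, if_neg]
    intro h
    apply hmod
    rw [← (mem_filter.1 hq).2]
    simpa using (hfib q hq).1.mul h

/-- The mean value of the weight over a dyadic interval is at least a constant times a power of the
logarithm. -/
theorem exists_sum_roughWeight_ge (n : ℕ) {Q : ℕ} (hQ : 0 < Q) :
    ∃ c M₀ : ℝ, 0 < c ∧ 1 ≤ M₀ ∧ ∀ M : ℝ, M₀ ≤ M → c * (M * Real.log M ^ n) ≤
      ∑ a ∈ Icc 1 ⌊M⌋₊ with M / 2 < ((a : ℕ) : ℝ), roughWeight (n + 1) Q a := by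
  have hQ' : (1 : ℝ) ≤ Q := by exact_mod_cast hQ
  induction n with
  | zero =>
    refine ⟨1 / (4 * Q), 8 * Q, by positivity, by linarith, fun M hM => ?_⟩
    calc 1 / (4 * Q) * (M * Real.log M ^ 0) = M / (4 * Q) := by rw [pow_zero]; ring
      _ ≤ _ := card_dyadic_modEq_ge hQ hM
      _ = _ := by
          rw [← filter_filter, card_filter]
          simp only [zero_add, roughWeight, Nat.cast_one, one_pow]
          push_cast
          rfl
  | succ n ih =>
    obtain ⟨c, M₀, hc, hM₀, h⟩ := ih
    -- Cofactors up to `√M` leave `M / x ≥ √M`, and the lower bound on `M` makes the harmonic sum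
    -- over the residue class `1` modulo `Q` at least `log M / (4 * Q)`.
    refine ⟨c / 2 ^ n * (1 / Q * (1 / 4)), M₀ ^ 2 + (2 * Q) ^ 4, by positivity,
      by nlinarith [show (0 : ℝ) ≤ (2 * Q) ^ 4 by positivity], fun M hM => ?_⟩
    have hM1 : M₀ ^ 2 ≤ M := le_trans (by simp) hM
    have hM2 : (2 * (Q : ℝ)) ^ 4 ≤ M := le_trans (by nlinarith) hM
    have hMpos : 1 ≤ M := le_trans (one_le_pow₀ hM₀) hM1
    have hs : √M * √M = M := Real.mul_self_sqrt (by linarith)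
    have hs1 : 1 ≤ √M := Real.one_le_sqrt.2 hMpos
    have hsM₀ : M₀ ≤ √M := Real.le_sqrt_of_sq_le hM1
    have hlogs : Real.log √M = Real.log M / 2 := Real.log_sqrt (by linarith)
    have hlogM := Real.log_nonneg hMpos
    set Z := ⌊√M⌋₊
    have hZ : √M / 2 ≤ Z := by
      have h1 := Nat.lt_floor_add_one √M
      have h2 : (1 : ℝ) ≤ Z := by exact_mod_cast Nat.le_floor (by simpa using hs1)
      linarith
    have hsQ : (2 * (Q : ℝ)) ^ 2 ≤ √M := Real.le_sqrt_of_sq_le (by rw [← pow_mul]; exact hM2)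
    have hQZ : Q ≤ Z := by
      have : (Q : ℝ) ≤ Z := by nlinarith
      exact_mod_cast this
    have hlogZ : 1 / 4 * Real.log M ≤ Real.log (Z / Q) := by
      have h1 : Real.log (√M / 2 / Q) ≤ Real.log (Z / Q) :=
        Real.log_le_log (by positivity) (by gcongr)
      have h2 : Real.log (√M / 2 / Q) = Real.log M / 2 - Real.log (2 * Q) := by
        rw [div_div, Real.log_div (by positivity) (by positivity), hlogs]
      have h3 : 4 * Real.log (2 * Q) ≤ Real.log M := by
        have := Real.log_le_log (by positivity) hM2
        rwa [Real.log_pow] at this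
      linarith
    refine le_trans ?_ (sum_sum_roughWeight_le n Q Z (by linarith))
    calc c / 2 ^ n * (1 / Q * (1 / 4)) * (M * Real.log M ^ (n + 1))
        = c * (M * (Real.log M / 2) ^ n) * (1 / Q * (1 / 4 * Real.log M)) := by
          rw [div_pow, pow_succ]; ring
      _ ≤ c * (M * (Real.log M / 2) ^ n) *
            ∑ x ∈ Icc 1 Z with x ≡ 1 [MOD Q], (x : ℝ)⁻¹ := by
          refine mul_le_mul_of_nonneg_left (le_trans ?_ (sum_inv_modEq_ge hQ hQZ)) (by positivity)
          gcongr
      _ = ∑ x ∈ Icc 1 Z with x ≡ 1 [MOD Q], c * (M / x * (Real.log M / 2) ^ n) := by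
          rw [mul_sum]
          exact sum_congr rfl fun x _ => by rw [div_eq_mul_inv]; ring
      _ ≤ _ := by
          refine sum_le_sum fun x hx => ?_
          have hx := mem_Icc.1 (mem_filter.1 hx).1
          have hx0 : (0 : ℝ) < x := by exact_mod_cast hx.1
          have hxs : (x : ℝ) ≤ √M := (Nat.le_floor_iff (by positivity)).1 hx.2
          have hMx : √M ≤ M / x := by rw [le_div_iff₀ hx0]; nlinarith
          refine le_trans ?_ (h (M / x) (hsM₀.trans hMx))
          have : Real.log M / 2 ≤ Real.log (M / x) :=
            hlogs ▸ Real.log_le_log (by linarith) hMx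
          gcongr

/-! ### Refinement matrices and the multiplicative energy -/

theorem exists_prod_eq_of_dvd_prod {n : ℕ} {a : ℕ} {b : Fin n → ℕ} (h : a ∣ ∏ j, b j) :
    ∃ y : Fin n → ℕ, a = ∏ j, y j ∧ ∀ j, y j ∣ b j := by
  induction n generalizing a with
  | zero => exact ⟨b, by simpa using h, fun j => j.elim0⟩
  | succ n ih =>
    rw [Fin.prod_univ_succ] at h
    obtain ⟨a₁, a₂, h₁, h₂, rfl⟩ := exists_dvd_and_dvd_of_dvd_mul h
    obtain ⟨y, rfl, hy⟩ := ih h₂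
    refine ⟨Fin.cons a₁ y, by simp [Fin.prod_univ_succ], fun j => ?_⟩
    refine Fin.cases ?_ (fun i => ?_) j
    · simpa using h₁
    · simpa using hy i

/-- Two factorizations of the same positive integer have a common refinement: a matrix whose row
products are the factors of one and whose column products are the factors of the other. -/
theorem exists_matrix_of_prod_eq_prod {m n : ℕ} {a : Fin m → ℕ} {b : Fin n → ℕ}
    (ha : ∀ i, a i ≠ 0) (h : ∏ i, a i = ∏ j, b j) :
    ∃ x : Fin m → Fin n → ℕ, (∀ i, a i = ∏ j, x i j) ∧ ∀ j, b j = ∏ i, x i j := by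
  induction m generalizing b with
  | zero =>
    refine ⟨fun _ _ => 1, fun i => i.elim0, fun j => ?_⟩
    have h1 : ∏ j, b j = 1 := by simpa using h.symm
    simpa using Nat.dvd_one.1 (h1 ▸ dvd_prod_of_mem b (mem_univ j))
  | succ m ih =>
    rw [Fin.prod_univ_succ] at h
    obtain ⟨y, hy, hyb⟩ := exists_prod_eq_of_dvd_prod (Dvd.intro _ h)
    choose b' hb' using hyb
    have h2 : ∏ i : Fin m, a i.succ = ∏ j, b' j := by
      apply Nat.eq_of_mul_eq_mul_left (Nat.pos_of_ne_zero (ha 0))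
      rw [h]
      nth_rw 1 [hy]
      rw [← prod_mul_distrib]
      exact prod_congr rfl fun j _ => hb' j
    obtain ⟨x, hx, hxb⟩ := ih (fun i => ha i.succ) h2
    refine ⟨Fin.cons y x, fun i => ?_, fun j => ?_⟩
    · refine Fin.cases ?_ (fun i => ?_) i
      · simpa using hy
      · simpa using hx i
    · rw [Fin.prod_univ_succ]
      simp [hb' j, ← hxb j]

/-- The summand is of size `1 / v` (up to normalization) where `v * R` and `c` are comparable, and
decays on both sides of this range, so the sum is bounded independently of its length. Up to the
factor `8 / (√R * √c)`, the summand is at most the increment of `v ↦ √(v * R) / (√c + √(v * R))`,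
which stays below `1`. -/
theorem sum_inv_sqrt_mul_le (y : ℕ) {R c : ℝ} (hR : 0 < R) (hc : 0 < c) :
    ∑ v ∈ Icc 1 y, (√v)⁻¹ * (4 / (√c + √(v * R)) ^ 2) ≤ 8 * ((√R)⁻¹ * (√c)⁻¹) := by
  set ψ : ℕ → ℝ := fun v => √(v * R) / (√c + √(v * R)) with hψ
  have hc' : 0 < √c := Real.sqrt_pos.2 hc
  have hR' : 0 < √R := Real.sqrt_pos.2 hR
  have key : ∀ v ∈ Icc 1 y, (√v)⁻¹ * (4 / (√c + √(v * R)) ^ 2) ≤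
      8 * ((√R)⁻¹ * (√c)⁻¹) * (ψ v - ψ (v - 1)) := by
    intro v hv
    obtain ⟨u, rfl⟩ : ∃ u, v = u + 1 := ⟨v - 1, by have := (mem_Icc.1 hv).1; omega⟩
    simp only [hψ, Nat.add_sub_cancel]
    rw [Real.sqrt_mul (Nat.cast_nonneg _), Real.sqrt_mul (Nat.cast_nonneg _)]
    set s := √((u : ℕ) : ℝ)
    set t := √((u + 1 : ℕ) : ℝ)
    have hs0 : 0 ≤ s := Real.sqrt_nonneg _
    have ht0 : 0 < t := Real.sqrt_pos.2 (by positivity)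
    have hst : s ≤ t := Real.sqrt_le_sqrt (by push_cast; linarith)
    have hdiff : t ^ 2 - s ^ 2 = 1 := by
      rw [Real.sq_sqrt (by positivity), Real.sq_sqrt (by positivity)]
      push_cast; ring
    have h1 : t * √R / (√c + t * √R) - s * √R / (√c + s * √R) =
        √c * √R * (t - s) / ((√c + t * √R) * (√c + s * √R)) := by
      field_simp
      ring
    have h2 : 1 / (2 * t) ≤ t - s := by
      rw [div_le_iff₀ (by positivity)]
      nlinarith
    have h3 : (√c + t * √R) * (√c + s * √R) ≤ (√c + t * √R) ^ 2 := by
      rw [sq]; gcongr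
    rw [h1]
    calc t⁻¹ * (4 / (√c + t * √R) ^ 2)
        = 8 * ((√R)⁻¹ * (√c)⁻¹) * (√c * √R * (1 / (2 * t)) / (√c + t * √R) ^ 2) := by
          field_simp
          norm_num
      _ ≤ 8 * ((√R)⁻¹ * (√c)⁻¹) *
            (√c * √R * (t - s) / ((√c + t * √R) * (√c + s * √R))) := by
          gcongr
  refine (sum_le_sum key).trans ?_
  rw [← mul_sum]
  have htel : ∑ v ∈ Icc 1 y, (ψ v - ψ (v - 1)) = ψ y - ψ 0 := by
    clear_value ψ
    clear key
    induction y with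
    | zero => simp
    | succ y ih => rw [sum_Icc_succ_top (by omega), ih, Nat.add_sub_cancel]; ring
  have hψ0 : ψ 0 = 0 := by simp [hψ]
  have hψy : ψ y ≤ 1 := by
    rw [hψ]
    exact div_le_one_of_le₀ (by linarith) (by positivity)
  rw [htel, hψ0, sub_zero]
  exact mul_le_of_le_one_right (by positivity) hψy

theorem inv_max_le {r c : ℝ} (hr : 0 < r) (hc : 0 < c) :
    (max r c)⁻¹ ≤ 4 / (√c + √r) ^ 2 := by
  have hm : 0 < max r c := lt_max_of_lt_left hr
  have h1 : √r ≤ √(max r c) := Real.sqrt_le_sqrt (le_max_left _ _)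
  have h2 : √c ≤ √(max r c) := Real.sqrt_le_sqrt (le_max_right _ _)
  have h3 : √(max r c) ^ 2 = max r c := Real.sq_sqrt hm.le
  have h4 := Real.sqrt_pos.2 hr
  have h5 := Real.sqrt_pos.2 hc
  rw [inv_eq_one_div, div_le_div_iff₀ hm (by positivity)]
  nlinarith

theorem inv_max_le_inv_sqrt_mul {r c : ℝ} (hr : 0 < r) (hc : 0 < c) :
    (max r c)⁻¹ ≤ (√r)⁻¹ * (√c)⁻¹ := by
  have hm : 0 < max r c := lt_max_of_lt_left hr
  have h1 : √r ≤ √(max r c) := Real.sqrt_le_sqrt (le_max_left _ _)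
  have h2 : √c ≤ √(max r c) := Real.sqrt_le_sqrt (le_max_right _ _)
  have h3 : √(max r c) * √(max r c) = max r c := Real.mul_self_sqrt hm.le
  have h4 := Real.sqrt_pos.2 hr
  have h5 := Real.sqrt_pos.2 hc
  rw [← mul_inv]
  exact inv_anti₀ (by positivity) (h3 ▸ mul_le_mul h1 h2 h5.le (h4.le.trans h1))

/-- The tuples of `n` positive integers up to `y`. -/
abbrev tupleBox (n y : ℕ) : Finset (Fin n → ℕ) := Fintype.piFinset fun _ => Icc 1 y

/-- The number of pairs of `n`-tuples `a`, `b` of positive integers up to `y` with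
`∏ aᵢ = ∏ bᵢ`. -/
def multiplicativeEnergy (n y : ℕ) : ℕ :=
  #{q ∈ tupleBox n y ×ˢ tupleBox n y | ∏ i, q.1 i = ∏ i, q.2 i}

/-- For given off-diagonal entries `w`, `v` of a refinement matrix, upper bounds for its diagonal
entries. The entries of row `i + 1` are `v i` in column `0`, and `w i j` in column `j + 1 ≠ i + 1`;
the entry of row `0` in column `i + 1` is `w i i`. -/
def diagonalBound {n : ℕ} (y : ℕ) (w : Fin n → Fin n → ℕ) (v : Fin n → ℕ) : Fin (n + 1) → ℕ :=
  Fin.cons (y / max (∏ i, w i i) (∏ i, v i))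
    fun i => y / max (v i * ∏ j ∈ univ.erase i, w i j) (∏ j, w j i)

/-- The pair of tuples of row products and column products of the matrix with off-diagonal
entries `w`, `v` and diagonal `d`. -/
def rowColProducts {n : ℕ} (w : Fin n → Fin n → ℕ) (v : Fin n → ℕ) (d : Fin (n + 1) → ℕ) :
    (Fin (n + 1) → ℕ) × (Fin (n + 1) → ℕ) :=
  (Fin.cons (d 0 * ∏ i, w i i) fun i => d i.succ * (v i * ∏ j ∈ univ.erase i, w i j),
    Fin.cons (d 0 * ∏ i, v i) fun i => d i.succ * ∏ j, w j i)

/-- Every solution of `∏ aᵢ = ∏ bᵢ` arises from some matrix whose diagonal respects the bounds. -/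
theorem exists_rowColProducts_eq {n y : ℕ} {a b : Fin (n + 1) → ℕ} (ha : a ∈ tupleBox (n + 1) y)
    (hb : b ∈ tupleBox (n + 1) y) (h : ∏ i, a i = ∏ i, b i) :
    ∃ w ∈ Fintype.piFinset fun _ : Fin n => tupleBox n y, ∃ v ∈ tupleBox n y,
      ∃ d ∈ Fintype.piFinset fun i => Icc 1 (diagonalBound y w v i),
        rowColProducts w v d = (a, b) := by
  simp only [Fintype.mem_piFinset, mem_Icc] at ha hb
  obtain ⟨x, hx, hx'⟩ := exists_matrix_of_prod_eq_prod (fun i => Nat.one_le_iff_ne_zero.1 (ha i).1) h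
  have hxle : ∀ i j, 1 ≤ x i j ∧ x i j ≤ y := by
    intro i j
    have hdvd : x i j ∣ a i := by rw [hx i]; exact dvd_prod_of_mem _ (mem_univ j)
    exact ⟨Nat.pos_of_dvd_of_pos hdvd (ha i).1, (Nat.le_of_dvd (ha i).1 hdvd).trans (ha i).2⟩
  set w : Fin n → Fin n → ℕ := fun i j => if i = j then x 0 j.succ else x i.succ j.succ with hw
  set v : Fin n → ℕ := fun i => x i.succ 0 with hv
  have hrow0 : a 0 = x 0 0 * ∏ i, w i i := by
    rw [hx 0, Fin.prod_univ_succ]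
    simp [hw]
  have hcol0 : b 0 = x 0 0 * ∏ i, v i := by
    rw [hx' 0, Fin.prod_univ_succ]
  have hrow : ∀ i : Fin n, a i.succ =
      x i.succ i.succ * (v i * ∏ j ∈ univ.erase i, w i j) := by
    intro i
    rw [hx i.succ, Fin.prod_univ_succ, ← mul_prod_erase univ _ (mem_univ i)]
    have : ∏ j ∈ univ.erase i, x i.succ j.succ = ∏ j ∈ univ.erase i, w i j :=
      prod_congr rfl fun j hj => by simp [hw, (ne_of_mem_erase hj).symm]
    rw [this]
    ring
  have hcol : ∀ i : Fin n, b i.succ = x i.succ i.succ * ∏ j, w j i := by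
    intro i
    rw [hx' i.succ, Fin.prod_univ_succ, ← mul_prod_erase univ _ (mem_univ i),
      ← mul_prod_erase univ (fun j => w j i) (mem_univ i)]
    have : ∏ j ∈ univ.erase i, x j.succ i.succ = ∏ j ∈ univ.erase i, w j i :=
      prod_congr rfl fun j hj => by simp [hw, ne_of_mem_erase hj]
    rw [this]
    simp only [hw, if_true]
    ring
  have hdiv : ∀ {d r c A B : ℕ}, A = d * r → B = d * c → 1 ≤ A → 1 ≤ B → A ≤ y → B ≤ y →
      d ≤ y / max r c := by
    intro d r c A B hA hB hA1 hB1 hAy hBy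
    have hr : 0 < r := Nat.pos_of_ne_zero fun h0 => by simp [h0] at hA; omega
    rw [Nat.le_div_iff_mul_le (lt_max_of_lt_left hr)]
    rcases max_choice r c with h' | h' <;> rw [h'] <;> omega
  refine ⟨w, ?_, v, ?_, fun i => x i i, ?_, ?_⟩
  · simp only [Fintype.mem_piFinset, mem_Icc]
    intro i j
    simp only [hw]
    split_ifs
    · exact hxle _ _
    · exact hxle _ _
  · simp only [Fintype.mem_piFinset, mem_Icc]
    exact fun i => hxle _ _
  · simp only [Fintype.mem_piFinset, mem_Icc]
    refine fun i => ⟨(hxle i i).1, ?_⟩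
    refine Fin.cases ?_ (fun i => ?_) i
    · exact hdiv hrow0 hcol0 (ha 0).1 (hb 0).1 (ha 0).2 (hb 0).2
    · exact hdiv (hrow i) (hcol i) (ha _).1 (hb _).1 (ha _).2 (hb _).2
  · refine Prod.ext (funext fun i => ?_) (funext fun i => ?_)
    · refine Fin.cases ?_ (fun i => ?_) i
      · exact hrow0.symm
      · exact (hrow i).symm
    · refine Fin.cases ?_ (fun i => ?_) i
      · exact hcol0.symm
      · exact (hcol i).symm

theorem multiplicativeEnergy_le_sum (n y : ℕ) :
    multiplicativeEnergy (n + 1) y ≤ ∑ w ∈ Fintype.piFinset fun _ : Fin n => tupleBox n y,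
      ∑ v ∈ tupleBox n y, ∏ i, diagonalBound y w v i := by
  rw [multiplicativeEnergy, ← sum_product']
  have hsub : {q ∈ tupleBox (n + 1) y ×ˢ tupleBox (n + 1) y | ∏ i, q.1 i = ∏ i, q.2 i} ⊆
      ((Fintype.piFinset fun _ : Fin n => tupleBox n y) ×ˢ tupleBox n y).biUnion fun q =>
        (Fintype.piFinset fun i => Icc 1 (diagonalBound y q.1 q.2 i)).image
          (rowColProducts q.1 q.2) := by
    rintro ⟨a, b⟩ hab
    obtain ⟨hab, h⟩ := mem_filter.1 hab
    obtain ⟨ha, hb⟩ := mem_product.1 hab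
    obtain ⟨w, hw, v, hv, d, hd, hdab⟩ := exists_rowColProducts_eq ha hb h
    exact mem_biUnion.2 ⟨(w, v), mem_product.2 ⟨hw, hv⟩, mem_image.2 ⟨d, hd, hdab⟩⟩
  refine (card_le_card hsub).trans (card_biUnion_le.trans (sum_le_sum fun q _ => ?_))
  refine card_image_le.trans ?_
  rw [Fintype.card_piFinset]
  simp

/-- The number of admissible diagonals for given off-diagonal entries. The factors `1 / max r c` are
replaced by quantities that remain concentrated where the row product `r` and the column product `c`
are comparable; for row and column `0` only the geometric mean is kept. -/
theorem prod_diagonalBound_le {n : ℕ} (y : ℕ) {w : Fin n → Fin n → ℕ} {v : Fin n → ℕ}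
    (hw : ∀ i j, 1 ≤ w i j) (hv : ∀ i, 1 ≤ v i) :
    ((∏ i, diagonalBound y w v i : ℕ) : ℝ) ≤ (y : ℝ) ^ (n + 1) * (√(∏ i, (w i i : ℝ)))⁻¹ *
      ∏ i, ((√(v i))⁻¹ * (4 / (√(∏ j, (w j i : ℝ)) +
        √(v i * ∏ j ∈ univ.erase i, (w i j : ℝ))) ^ 2)) := by
  have hw' : ∀ i j, (0 : ℝ) < w i j := fun i j => by exact_mod_cast hw i j
  have hv' : ∀ i, (0 : ℝ) < v i := fun i => by exact_mod_cast hv i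
  rw [Fin.prod_univ_succ]
  push_cast
  have h0 : (diagonalBound y w v 0 : ℝ) ≤
      y * ((√(∏ i, (w i i : ℝ)))⁻¹ * (√(∏ i, (v i : ℝ)))⁻¹) := by
    refine (Nat.cast_div_le).trans ?_
    push_cast
    rw [div_eq_mul_inv]
    gcongr
    exact inv_max_le_inv_sqrt_mul (prod_pos fun i _ => hw' i i) (prod_pos fun i _ => hv' i)
  have h1 : ∀ i : Fin n, (diagonalBound y w v i.succ : ℝ) ≤
      y * (4 / (√(∏ j, (w j i : ℝ)) + √(v i * ∏ j ∈ univ.erase i, (w i j : ℝ))) ^ 2) := by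
    intro i
    refine (Nat.cast_div_le).trans ?_
    push_cast
    rw [div_eq_mul_inv]
    gcongr
    exact inv_max_le (mul_pos (hv' i) (prod_pos fun j _ => hw' i j)) (prod_pos fun j _ => hw' j i)
  calc _ ≤ (y * ((√(∏ i, (w i i : ℝ)))⁻¹ * (√(∏ i, (v i : ℝ)))⁻¹)) * ∏ i : Fin n,
        (y * (4 / (√(∏ j, (w j i : ℝ)) + √(v i * ∏ j ∈ univ.erase i, (w i j : ℝ))) ^ 2)) :=
        mul_le_mul h0 (prod_le_prod (fun _ _ => Nat.cast_nonneg _) fun i _ => h1 i)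
          (prod_nonneg fun _ _ => Nat.cast_nonneg _) (by positivity)
    _ = _ := by
        rw [Real.sqrt_prod univ fun i _ => (hv' i).le, prod_mul_distrib, prod_mul_distrib,
          prod_inv_distrib]
        simp only [prod_const, card_univ, Fintype.card_fin]
        ring

/-- Each entry `v i` occurs in the product of row `i + 1` but not of column `i + 1`, so summing over
`v` uses the concentration `r ≈ c` once for each `i`. -/
theorem sum_prod_diagonalBound_le {n : ℕ} (y : ℕ) {w : Fin n → Fin n → ℕ}
    (hw : ∀ i j, 1 ≤ w i j) :
    ∑ v ∈ tupleBox n y, ((∏ i, diagonalBound y w v i : ℕ) : ℝ) ≤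
      8 ^ n * (y : ℝ) ^ (n + 1) * ∏ i, ∏ j, (w i j : ℝ)⁻¹ := by
  have hw' : ∀ i j, (0 : ℝ) < w i j := fun i j => by exact_mod_cast hw i j
  calc _ ≤ ∑ v ∈ tupleBox n y, (y : ℝ) ^ (n + 1) * (√(∏ i, (w i i : ℝ)))⁻¹ *
      ∏ i, ((√(v i))⁻¹ * (4 / (√(∏ j, (w j i : ℝ)) +
        √(v i * ∏ j ∈ univ.erase i, (w i j : ℝ))) ^ 2)) :=
        sum_le_sum fun v hv => prod_diagonalBound_le y hw fun i =>
          (mem_Icc.1 (Fintype.mem_piFinset.1 hv i)).1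
    _ = (y : ℝ) ^ (n + 1) * (√(∏ i, (w i i : ℝ)))⁻¹ *
        ∏ i, ∑ v ∈ Icc 1 y, ((√(v : ℝ))⁻¹ * (4 / (√(∏ j, (w j i : ℝ)) +
        √(v * ∏ j ∈ univ.erase i, (w i j : ℝ))) ^ 2)) := by
        rw [← mul_sum, ← sum_prod_piFinset (Icc 1 y) fun i v => ((√(v : ℝ))⁻¹ *
          (4 / (√(∏ j, (w j i : ℝ)) + √(v * ∏ j ∈ univ.erase i, (w i j : ℝ))) ^ 2))]
    _ ≤ (y : ℝ) ^ (n + 1) * (√(∏ i, (w i i : ℝ)))⁻¹ *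
        ∏ i, (8 * ((√(∏ j ∈ univ.erase i, (w i j : ℝ)))⁻¹ * (√(∏ j, (w j i : ℝ)))⁻¹)) := by
        gcongr with i
        exact sum_inv_sqrt_mul_le y (prod_pos fun j _ => hw' i j) (prod_pos fun j _ => hw' j i)
    _ = 8 ^ n * (y : ℝ) ^ (n + 1) * ((∏ i, (√(w i i : ℝ) *
          √(∏ j ∈ univ.erase i, (w i j : ℝ)))⁻¹) * ∏ i, (√(∏ j, (w j i : ℝ)))⁻¹) := by
        rw [Real.sqrt_prod univ fun i _ => (hw' i i).le]
        simp only [prod_mul_distrib, prod_inv_distrib, prod_const, card_univ, Fintype.card_fin,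
          mul_inv]
        ring
    -- Each `w i j` occurs once in a row product and once in a column product.
    _ = 8 ^ n * (y : ℝ) ^ (n + 1) * ((∏ i, ∏ j, (√(w i j : ℝ))⁻¹) *
          ∏ i, ∏ j, (√(w i j : ℝ))⁻¹) := by
        congr 2
        · refine prod_congr rfl fun i _ => ?_
          rw [← Real.sqrt_mul (hw' i i).le, mul_prod_erase univ (fun j => (w i j : ℝ)) (mem_univ i),
            Real.sqrt_prod univ fun j _ => (hw' i j).le, prod_inv_distrib]
        · rw [prod_comm]
          refine prod_congr rfl fun i _ => ?_
          rw [Real.sqrt_prod univ fun j _ => (hw' j i).le, prod_inv_distrib]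
    _ = _ := by
        simp only [← prod_mul_distrib, ← mul_inv, Real.mul_self_sqrt (Nat.cast_nonneg _)]

/-- The sharp upper bound for the multiplicative energy. Solutions are parametrized by refinement
matrices of size `n + 1`; of the `n * (n + 1)` off-diagonal entries, `n` are pinned up to a bounded
logarithmic mass by the requirement that corresponding row and column products be of similar
size. -/
theorem multiplicativeEnergy_le (n y : ℕ) :
    (multiplicativeEnergy (n + 1) y : ℝ) ≤
      8 ^ n * (y : ℝ) ^ (n + 1) * (1 + Real.log y) ^ (n ^ 2) := by
  calc (multiplicativeEnergy (n + 1) y : ℝ)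
      ≤ ∑ w ∈ Fintype.piFinset fun _ : Fin n => tupleBox n y,
          ∑ v ∈ tupleBox n y, ((∏ i, diagonalBound y w v i : ℕ) : ℝ) := by
        exact_mod_cast multiplicativeEnergy_le_sum n y
    _ ≤ ∑ w ∈ Fintype.piFinset fun _ : Fin n => tupleBox n y,
          8 ^ n * (y : ℝ) ^ (n + 1) * ∏ i, ∏ j, (w i j : ℝ)⁻¹ :=
        sum_le_sum fun w hw => sum_prod_diagonalBound_le y fun i j =>
          (mem_Icc.1 (Fintype.mem_piFinset.1 (Fintype.mem_piFinset.1 hw i) j)).1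
    _ = 8 ^ n * (y : ℝ) ^ (n + 1) * (∑ x ∈ Icc 1 y, (x : ℝ)⁻¹) ^ (n ^ 2) := by
        rw [← mul_sum, sum_prod_piFinset (tupleBox n y) fun _ u => ∏ j, (u j : ℝ)⁻¹]
        rw [sum_prod_piFinset (Icc 1 y) fun _ x => (x : ℝ)⁻¹]
        simp only [prod_const, card_univ, Fintype.card_fin, ← pow_mul, sq]
    _ ≤ _ := by
        have := sum_inv_Icc_le y
        gcongr

/-! ### Orthogonality and moments of character polynomials -/

theorem conj_dirichletCharacter {p : ℕ} [Fact p.Prime] (χ : DirichletCharacter ℂ p) (a : ZMod p) :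
    conj (χ a) = χ a⁻¹ := by
  rw [← MulChar.inv_apply', ← MulChar.star_apply']
  rfl

theorem sum_char_mul_conj {p : ℕ} [Fact p.Prime] (u : ZMod p) {v : ZMod p} (hv : v ≠ 0) :
    ∑ χ : DirichletCharacter ℂ p, χ u * conj (χ v) = if u = v then (p : ℂ) - 1 else 0 := by
  have h := DirichletCharacter.sum_char_inv_mul_char_eq ℂ (IsUnit.mk0 v hv) u
  have hp : ((p.totient : ℕ) : ℂ) = (p : ℂ) - 1 := by
    rw [Nat.totient_prime Fact.out, Nat.cast_sub (Nat.Prime.one_le Fact.out), Nat.cast_one]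
  simp only [hp] at h
  simp only [conj_dirichletCharacter, mul_comm (_ : ℂ), eq_comm (a := u)] at h ⊢
  exact h

/-- Orthogonality for the characters of a given parity. -/
theorem sum_parity_char_mul_conj {p : ℕ} [Fact p.Prime] {ε : ℝ} (hε : ε = 1 ∨ ε = -1)
    (u : ZMod p) {v : ZMod p} (hv : v ≠ 0) :
    ∑ χ : DirichletCharacter ℂ p with χ (-1) = (ε : ℂ), χ u * conj (χ v) =
      (((p - 1) / 2 * ((if u = v then 1 else 0) + ε * if u = -v then 1 else 0) : ℝ) : ℂ) := by
  have h1 : ∀ χ : DirichletCharacter ℂ p, (if χ (-1) = (ε : ℂ) then χ u * conj (χ v) else 0) =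
      1 / 2 * (χ u * conj (χ v)) + ε / 2 * (χ (-u) * conj (χ v)) := by
    intro χ
    have h2 : χ (-u) = χ (-1) * χ u := by rw [← map_mul, neg_one_mul]
    rcases χ.even_or_odd with h | h
    · have h : χ (-1) = 1 := h
      rw [h2, h]
      rcases hε with rfl | rfl
      · simp; ring
      · rw [if_neg (by norm_num)]; push_cast; ring
    · have h : χ (-1) = -1 := h
      rw [h2, h]
      rcases hε with rfl | rfl
      · rw [if_neg (by norm_num)]; push_cast; ring
      · simp; ring
  rw [sum_filter, sum_congr rfl fun χ _ => h1 χ, sum_add_distrib, ← mul_sum, ← mul_sum,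
    sum_char_mul_conj u hv, sum_char_mul_conj (-u) hv]
  simp only [neg_eq_iff_eq_neg]
  split_ifs <;> push_cast <;> ring

theorem natCast_zmod_inj {p a b : ℕ} (ha : a < p) (hb : b < p) :
    ((a : ZMod p) = (b : ZMod p)) ↔ a = b := by
  rw [ZMod.natCast_eq_natCast_iff', Nat.mod_eq_of_lt ha, Nat.mod_eq_of_lt hb]

theorem natCast_zmod_ne_zero {p a : ℕ} (ha : 1 ≤ a) (hap : a < p) : (a : ZMod p) ≠ 0 := by
  rw [Ne, ZMod.natCast_eq_zero_iff]
  exact fun h => absurd (Nat.le_of_dvd ha h) (by omega)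

/-- The second moment of a character polynomial of length less than `p`. -/
theorem sum_norm_sq_char_poly {p : ℕ} [Fact p.Prime] {ι : Type*} (I : Finset ι) {α : ι → ℕ}
    (hα : ∀ s ∈ I, 1 ≤ α s ∧ α s < p) (β : ι → ℝ) :
    ∑ χ : DirichletCharacter ℂ p, ‖∑ s ∈ I, (β s : ℂ) * χ (α s)‖ ^ 2 =
      (p - 1) * ∑ s ∈ I, ∑ t ∈ I, if α s = α t then β s * β t else 0 := by
  have h : ((∑ χ : DirichletCharacter ℂ p, ‖∑ s ∈ I, (β s : ℂ) * χ (α s)‖ ^ 2 : ℝ) : ℂ) =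
      (((p - 1) * ∑ s ∈ I, ∑ t ∈ I, if α s = α t then β s * β t else 0 : ℝ) : ℂ) := by
    push_cast
    simp only [← Complex.mul_conj', map_sum, map_mul, Complex.conj_ofReal, sum_mul_sum]
    rw [sum_comm, mul_sum]
    refine sum_congr rfl fun s hs => ?_
    rw [sum_comm, mul_sum]
    refine sum_congr rfl fun t ht => ?_
    have h1 : ∀ χ : DirichletCharacter ℂ p, (β s : ℂ) * χ (α s) * ((β t : ℂ) * conj (χ (α t))) =
        (β s * β t : ℂ) * (χ (α s) * conj (χ (α t))) := fun χ => by ring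
    simp only [h1]
    rw [← mul_sum, sum_char_mul_conj _ (natCast_zmod_ne_zero (hα t ht).1 (hα t ht).2)]
    simp only [natCast_zmod_inj (hα s hs).2 (hα t ht).2]
    split_ifs
    · push_cast; ring
    · simp
  exact_mod_cast h

/-- The character sum over the integers from `1` to `y`. -/
noncomputable def charSum (p y : ℕ) (χ : DirichletCharacter ℂ p) : ℂ := ∑ a ∈ Icc 1 y, χ (a : ZMod p)

theorem charSum_pow (p y n : ℕ) (χ : DirichletCharacter ℂ p) :
    charSum p y χ ^ n = ∑ a ∈ tupleBox n y, χ ((∏ i, a i : ℕ) : ZMod p) := by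
  rw [charSum, sum_pow']
  refine sum_congr rfl fun a _ => ?_
  push_cast
  rw [map_prod]

theorem prod_mem_Icc_of_mem_tupleBox {n y : ℕ} {a : Fin n → ℕ} (ha : a ∈ tupleBox n y) :
    1 ≤ ∏ i, a i ∧ ∏ i, a i ≤ y ^ n := by
  simp only [Fintype.mem_piFinset, mem_Icc] at ha
  refine ⟨Nat.one_le_iff_ne_zero.2 (prod_ne_zero_iff.2 fun i _ =>
    Nat.one_le_iff_ne_zero.1 (ha i).1), ?_⟩
  calc _ ≤ ∏ _i : Fin n, y := prod_le_prod' fun i _ => (ha i).2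
    _ = _ := by simp

/-- A high moment of a short character sum counts the solutions of a multiplicative equation. -/
theorem sum_norm_charSum_pow {p : ℕ} [Fact p.Prime] {n y : ℕ} (hy : y ^ n < p) :
    ∑ χ : DirichletCharacter ℂ p, ‖charSum p y χ‖ ^ (2 * n) =
      (p - 1) * (multiplicativeEnergy n y : ℝ) := by
  have h := sum_norm_sq_char_poly (p := p) (tupleBox n y) (α := fun a => ∏ i, a i)
    (fun a ha => ⟨(prod_mem_Icc_of_mem_tupleBox ha).1,
      (prod_mem_Icc_of_mem_tupleBox ha).2.trans_lt hy⟩) fun _ => 1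
  simp only [Complex.ofReal_one, one_mul, ← charSum_pow, norm_pow] at h
  simp only [mul_comm 2 n, pow_mul]
  rw [h, multiplicativeEnergy, card_filter, sum_product]
  push_cast
  simp

/-- Hölder's inequality for the three-fold product that isolates the highest moment of `f`. -/
theorem sum_mul_pow_mul_pow_le {ι : Type*} (s : Finset ι) {f g h : ι → ℝ} (hf : ∀ i, 0 ≤ f i)
    (hg : ∀ i, 0 ≤ g i) (n : ℕ) :
    (∑ i ∈ s, f i * g i ^ n * h i) ^ (2 * (n + 1)) ≤
      (∑ i ∈ s, f i ^ (2 * (n + 1))) * (∑ i ∈ s, g i ^ (2 * (n + 1))) ^ n *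
        (∑ i ∈ s, h i ^ 2) ^ (n + 1) := by
  have h1 : (∑ i ∈ s, f i * g i ^ n * h i) ^ 2 ≤
      (∑ i ∈ s, (f i * g i ^ n) ^ 2) * ∑ i ∈ s, h i ^ 2 := sum_mul_sq_le_sq_mul_sq s _ _
  have h2 : (∑ i ∈ s, (f i * g i ^ n) ^ 2) ^ (n + 1) ≤
      (∑ i ∈ s, f i ^ (2 * (n + 1))) * (∑ i ∈ s, g i ^ (2 * (n + 1))) ^ n := by
    rcases Nat.eq_zero_or_pos n with rfl | hn
    · simp
    have hn' : (0 : ℝ) < n := by exact_mod_cast hn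
    have hpq : ((n : ℝ) + 1).HolderConjugate (((n : ℝ) + 1) / n) := by
      rw [Real.holderConjugate_iff]
      refine ⟨by linarith, ?_⟩
      field_simp
      ring
    have hA : 0 ≤ ∑ i ∈ s, f i ^ (2 * (n + 1)) := sum_nonneg fun i _ => pow_nonneg (hf i) _
    have hB : 0 ≤ ∑ i ∈ s, g i ^ (2 * (n + 1)) := sum_nonneg fun i _ => pow_nonneg (hg i) _
    have h3 := Real.inner_le_Lp_mul_Lq_of_nonneg s (f := fun i => f i ^ 2)
      (g := fun i => g i ^ (2 * n)) hpq (fun i _ => by positivity)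
      fun i _ => pow_nonneg (hg i) _
    have hf' : ∀ i, (f i ^ 2) ^ ((n : ℝ) + 1) = f i ^ (2 * (n + 1)) := by
      intro i
      rw [pow_mul, ← Real.rpow_natCast (f i ^ 2) (n + 1)]
      push_cast
      rfl
    have hg' : ∀ i, (g i ^ (2 * n)) ^ (((n : ℝ) + 1) / n) = g i ^ (2 * (n + 1)) := by
      intro i
      rw [← Real.rpow_natCast, ← Real.rpow_natCast, ← Real.rpow_mul (hg i)]
      congr 1
      push_cast
      field_simp
    simp only [hf', hg'] at h3
    calc (∑ i ∈ s, (f i * g i ^ n) ^ 2) ^ (n + 1)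
        = (∑ i ∈ s, f i ^ 2 * g i ^ (2 * n)) ^ (n + 1) := by
          congr 1
          exact sum_congr rfl fun i _ => by rw [mul_pow, ← pow_mul, mul_comm n 2]
      _ ≤ ((∑ i ∈ s, f i ^ (2 * (n + 1))) ^ (1 / ((n : ℝ) + 1)) *
            (∑ i ∈ s, g i ^ (2 * (n + 1))) ^ (1 / (((n : ℝ) + 1) / n))) ^ (n + 1) := by
          refine pow_le_pow_left₀ (sum_nonneg fun i _ => ?_) h3 _
          have := hg i
          positivity
      _ = _ := by
          rw [mul_pow, ← Real.rpow_natCast, ← Real.rpow_natCast, ← Real.rpow_mul hA,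
            ← Real.rpow_mul hB, ← Real.rpow_natCast (∑ i ∈ s, g i ^ (2 * (n + 1))) n]
          push_cast
          congr 1
          · rw [one_div_mul_cancel (by positivity), Real.rpow_one]
          · congr 1
            field_simp
  have hC : 0 ≤ ∑ i ∈ s, h i ^ 2 := sum_nonneg fun i _ => sq_nonneg _
  calc (∑ i ∈ s, f i * g i ^ n * h i) ^ (2 * (n + 1))
      = ((∑ i ∈ s, f i * g i ^ n * h i) ^ 2) ^ (n + 1) := by rw [pow_mul]
    _ ≤ ((∑ i ∈ s, (f i * g i ^ n) ^ 2) * ∑ i ∈ s, h i ^ 2) ^ (n + 1) := by gcongr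
    _ = (∑ i ∈ s, (f i * g i ^ n) ^ 2) ^ (n + 1) * (∑ i ∈ s, h i ^ 2) ^ (n + 1) := mul_pow _ _ _
    _ ≤ _ := by gcongr

/-! ### Theta series and their pairing with characters -/

/-- The coefficient of `χ(n)` in the theta function at `1` of a character modulo `p` of parity
`η`. -/
noncomputable def thetaWeight (p η n : ℕ) : ℝ := (n : ℝ) ^ η * Real.exp (-Real.pi * (n : ℝ) ^ 2 / p)

theorem thetaWeight_nonneg (p η n : ℕ) : 0 ≤ thetaWeight p η n := by
  unfold thetaWeight; positivity

theorem thetaSeries_one_eq (p η : ℕ) (χ : DirichletCharacter ℂ p) :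
    thetaSeries p η 1 χ =
      ∑' m : ℕ, χ ((m + 1 : ℕ) : ZMod p) * (thetaWeight p η (m + 1) : ℂ) := by
  simp only [thetaSeries, thetaWeight, mul_one, Complex.ofReal_mul, mul_assoc]

theorem summable_thetaWeight (p η : ℕ) [NeZero p] :
    Summable fun m : ℕ => thetaWeight p η (m + 1) := by
  have hp : (0 : ℝ) < p := by exact_mod_cast Nat.pos_of_ne_zero (NeZero.ne p)
  have h1 : Summable fun n : ℕ => (n : ℝ) ^ η * Real.exp (-(Real.pi / p) * n) :=
    Real.summable_pow_mul_exp_neg_nat_mul η (by positivity)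
  refine Summable.of_nonneg_of_le (fun m => thetaWeight_nonneg _ _ _) (fun m => ?_)
    ((summable_nat_add_iff 1).2 h1)
  unfold thetaWeight
  have h2 : (1 : ℝ) ≤ ((m + 1 : ℕ) : ℝ) := by exact_mod_cast Nat.le_add_left 1 m
  have h3 : -Real.pi * ((m + 1 : ℕ) : ℝ) ^ 2 / p = -(Real.pi / p) * ((m + 1 : ℕ) : ℝ) ^ 2 := by
    ring
  rw [h3, neg_mul, neg_mul]
  gcongr
  exact le_self_pow₀ h2 two_ne_zero

theorem summable_thetaWeight_mul {p : ℕ} [NeZero p] (η : ℕ) {g : ℕ → ℝ} {C : ℝ}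
    (hg : ∀ m, |g m| ≤ C) : Summable fun m : ℕ => thetaWeight p η (m + 1) * g m := by
  refine Summable.of_norm_bounded ((summable_thetaWeight p η).mul_right C) fun m => ?_
  rw [norm_mul, Real.norm_of_nonneg (thetaWeight_nonneg _ _ _)]
  exact mul_le_mul_of_nonneg_left (hg m) (thetaWeight_nonneg _ _ _)

theorem norm_thetaSeries_le (p η : ℕ) [NeZero p] (χ : DirichletCharacter ℂ p) :
    ‖thetaSeries p η 1 χ‖ ≤ ∑' m : ℕ, thetaWeight p η (m + 1) := by
  rw [thetaSeries_one_eq]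
  refine tsum_of_norm_bounded (summable_thetaWeight p η).hasSum fun m => ?_
  rw [norm_mul, Complex.norm_real, Real.norm_of_nonneg (thetaWeight_nonneg _ _ _)]
  exact mul_le_of_le_one_left (thetaWeight_nonneg _ _ _) (χ.norm_le_one _)

/-- The indicator of `u = v` plus `ε` times the indicator of `u = -v`. -/
def signedEq {p : ℕ} (ε : ℝ) (u v : ZMod p) : ℝ :=
  (if u = v then 1 else 0) + ε * if u = -v then 1 else 0

theorem abs_signedEq_le {p : ℕ} {ε : ℝ} (hε : ε = 1 ∨ ε = -1) (u v : ZMod p) :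
    |signedEq ε u v| ≤ 2 := by
  unfold signedEq
  rcases hε with rfl | rfl <;> split_ifs <;> norm_num

/-- Orthogonality applied to the theta series: summed over the characters of one parity, the
product of the theta series with a character polynomial counts solutions of congruences. -/
theorem sum_thetaSeries_mul_char_poly {p : ℕ} [Fact p.Prime] (η : ℕ) {ε : ℝ}
    (hε : ε = 1 ∨ ε = -1) {ι : Type*} (I : Finset ι) (u : ι → ZMod p) {v : ι → ZMod p}
    (hv : ∀ s ∈ I, v s ≠ 0) (β : ι → ℝ) :
    ∑ χ : DirichletCharacter ℂ p with χ (-1) = (ε : ℂ),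
        thetaSeries p η 1 χ * ∑ s ∈ I, (β s : ℂ) * (χ (u s) * conj (χ (v s))) =
      (((p - 1) / 2 * ∑' m : ℕ, thetaWeight p η (m + 1) *
        ∑ s ∈ I, β s * signedEq ε (((m + 1 : ℕ) : ZMod p) * u s) (v s) : ℝ) : ℂ) := by
  have hsum : ∀ χ : DirichletCharacter ℂ p,
      Summable fun m : ℕ => χ ((m + 1 : ℕ) : ZMod p) * (thetaWeight p η (m + 1) : ℂ) := by
    intro χ
    refine Summable.of_norm_bounded (summable_thetaWeight p η) fun m => ?_
    rw [norm_mul, Complex.norm_real, Real.norm_of_nonneg (thetaWeight_nonneg _ _ _)]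
    exact mul_le_of_le_one_left (thetaWeight_nonneg _ _ _) (χ.norm_le_one _)
  simp only [thetaSeries_one_eq, ← tsum_mul_right]
  rw [← Summable.tsum_finsetSum fun χ _ => (hsum χ).mul_right _, ← tsum_mul_left,
    Complex.ofReal_tsum]
  congr 1
  funext m
  have h1 : ∀ χ : DirichletCharacter ℂ p, χ ((m + 1 : ℕ) : ZMod p) *
      (thetaWeight p η (m + 1) : ℂ) * ∑ s ∈ I, (β s : ℂ) * (χ (u s) * conj (χ (v s))) =
      ∑ s ∈ I, (thetaWeight p η (m + 1) * β s : ℂ) *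
        (χ (((m + 1 : ℕ) : ZMod p) * u s) * conj (χ (v s))) := by
    intro χ
    rw [mul_sum]
    refine sum_congr rfl fun s _ => ?_
    rw [map_mul]
    ring
  simp only [h1]
  rw [sum_comm, mul_sum, mul_sum, Complex.ofReal_sum]
  refine sum_congr rfl fun s hs => ?_
  rw [← mul_sum, sum_parity_char_mul_conj hε _ (hv s hs)]
  unfold signedEq
  push_cast
  ring

theorem dirichletTheta_of_even {p : ℕ} {χ : DirichletCharacter ℂ p} (h : χ.Even) :
    dirichletTheta p 1 χ = thetaSeries p 0 1 χ := by
  rw [dirichletTheta, thetaParity, if_neg h.not_odd]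

theorem dirichletTheta_of_odd {p : ℕ} {χ : DirichletCharacter ℂ p} (h : χ.Odd) :
    dirichletTheta p 1 χ = thetaSeries p 1 1 χ := by
  rw [dirichletTheta, thetaParity, if_pos h]

theorem evenThetaMoment_eq (k p : ℕ) [Fact p.Prime] :
    evenThetaMoment k p = ∑ χ ∈ ({χ | χ (-1) = ((1 : ℝ) : ℂ)} :
      Finset (DirichletCharacter ℂ p)).erase 1, ‖thetaSeries p 0 1 χ‖ ^ (2 * k) := by
  unfold evenThetaMoment
  refine sum_congr ?_ fun χ hχ => ?_
  · ext χ
    simp [DirichletCharacter.Even, and_comm]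
  · have h : χ.Even := by simpa [DirichletCharacter.Even] using (mem_erase.1 hχ).2
    rw [dirichletTheta_of_even h]

theorem oddThetaMoment_eq (k p : ℕ) [Fact p.Prime] :
    oddThetaMoment k p = ∑ χ : DirichletCharacter ℂ p with χ (-1) = ((-1 : ℝ) : ℂ),
      ‖thetaSeries p 1 1 χ‖ ^ (2 * k) := by
  unfold oddThetaMoment
  refine sum_congr ?_ fun χ hχ => ?_
  · ext χ
    simp only [mem_filter, mem_univ, true_and]
    simp [DirichletCharacter.Odd]
  · have h : χ.Odd := by simpa [DirichletCharacter.Odd] using hχ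
    rw [dirichletTheta_of_odd h]

theorem evenThetaMoment_nonneg (k p : ℕ) : 0 ≤ evenThetaMoment k p :=
  sum_nonneg fun _ _ => by positivity

theorem oddThetaMoment_nonneg (k p : ℕ) : 0 ≤ oddThetaMoment k p :=
  sum_nonneg fun _ _ => by positivity

/-- For `n ≥ p - 2` the ratio to the weight at `2` is `exp (-π * (n - 2) * (n + 2) / p)`, hence at
most `exp (-π * (n - 2))`; half of the exponent is spent on decay in `p`. -/
theorem thetaWeight_even_tail_le {p n : ℕ} (hp : 0 < p) (hn : p - 2 ≤ n) (hn3 : 3 ≤ n) :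
    thetaWeight p 0 n ≤ thetaWeight p 0 2 * (Real.exp (-Real.pi * (p - 4) / 2) *
      Real.exp (-Real.pi / 2) ^ (n - 2)) := by
  have hp' : (0 : ℝ) < p := by exact_mod_cast hp
  have hn' : (p : ℝ) ≤ n + 2 := by exact_mod_cast (by omega : p ≤ n + 2)
  have hn3' : (3 : ℝ) ≤ n := by exact_mod_cast hn3
  have hpi := Real.pi_pos
  simp only [thetaWeight, pow_zero, one_mul]
  rw [← Real.exp_nat_mul, ← Real.exp_add, ← Real.exp_add, Real.exp_le_exp,
    Nat.cast_sub (by omega : 2 ≤ n)]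
  have h1 : -Real.pi * ((2 : ℕ) : ℝ) ^ 2 / p - -Real.pi * (n : ℝ) ^ 2 / p =
      Real.pi * ((n - 2) * (n + 2) / p) := by push_cast; field_simp; ring
  have h2 : (n : ℝ) - 2 ≤ (n - 2) * (n + 2) / p := by
    rw [le_div_iff₀ hp']
    nlinarith
  have h3 := mul_le_mul_of_nonneg_left h2 hpi.le
  have h4 : Real.pi * (p - 4) ≤ Real.pi * (n - 2) :=
    mul_le_mul_of_nonneg_left (by linarith) hpi.le
  push_cast
  push_cast at h1
  linarith

/-- For `n ≥ p - 1` the exponential factor decays from its value at `1` at least like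
`exp (-π * (n - 1))`, and the factor `n` is at most `2 ^ (n - 1)`. -/
theorem thetaWeight_odd_tail_le {p n : ℕ} (hp : 0 < p) (hn : p - 1 ≤ n) (hn1 : 1 ≤ n) :
    thetaWeight p 1 n ≤ thetaWeight p 1 1 * (2 * Real.exp (-Real.pi)) ^ (n - 1) := by
  have hp' : (0 : ℝ) < p := by exact_mod_cast hp
  have hn' : (p : ℝ) ≤ n + 1 := by exact_mod_cast (by omega : p ≤ n + 1)
  have hn1' : (1 : ℝ) ≤ n := by exact_mod_cast hn1
  have hpi := Real.pi_pos
  have h0 : (n : ℝ) ≤ 2 ^ (n - 1) := by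
    have : n - 1 < 2 ^ (n - 1) := Nat.lt_two_pow_self
    exact_mod_cast (by omega : n ≤ 2 ^ (n - 1))
  have h5 : Real.exp (-Real.pi * (n : ℝ) ^ 2 / p) ≤
      Real.exp (-Real.pi * ((1 : ℕ) : ℝ) ^ 2 / p) * Real.exp (-Real.pi) ^ (n - 1) := by
    rw [← Real.exp_nat_mul, ← Real.exp_add, Real.exp_le_exp, Nat.cast_sub hn1]
    have h1 : -Real.pi * ((1 : ℕ) : ℝ) ^ 2 / p - -Real.pi * (n : ℝ) ^ 2 / p =
        Real.pi * ((n - 1) * (n + 1) / p) := by push_cast; field_simp; ring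
    have h2 : (n : ℝ) - 1 ≤ (n - 1) * (n + 1) / p := by
      rw [le_div_iff₀ hp']
      nlinarith
    have h3 := mul_le_mul_of_nonneg_left h2 hpi.le
    push_cast
    push_cast at h1
    linarith
  calc thetaWeight p 1 n = n * Real.exp (-Real.pi * (n : ℝ) ^ 2 / p) := by
        simp [thetaWeight]
    _ ≤ 2 ^ (n - 1) * (Real.exp (-Real.pi * ((1 : ℕ) : ℝ) ^ 2 / p) *
          Real.exp (-Real.pi) ^ (n - 1)) := by gcongr
    _ = _ := by rw [thetaWeight, mul_pow]; simp; ring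

/-! ### Positivity of the moments -/

/-- The weight at `1` exceeds the weight at `2` together with the geometric bound for the weights
in the classes `± 2` from `p - 2` on. -/
theorem thetaWeight_two_add_tail_lt {p : ℕ} (hp : 5 ≤ p) :
    thetaWeight p 0 2 * (1 + Real.exp (-Real.pi * (p - 4) / 2) *
      (Real.exp (-Real.pi / 2) * (1 - Real.exp (-Real.pi / 2))⁻¹)) < thetaWeight p 0 1 := by
  have hp' : (5 : ℝ) ≤ p := by exact_mod_cast hp
  have hpi := Real.pi_gt_three
  have h1 : thetaWeight p 0 1 = thetaWeight p 0 2 * Real.exp (3 * Real.pi / p) := by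
    simp only [thetaWeight, pow_zero, one_mul]
    rw [← Real.exp_add]
    congr 1
    push_cast
    field_simp
    ring
  have hpos : 0 < thetaWeight p 0 2 := by simp only [thetaWeight]; positivity
  have h2 : 3 * Real.pi / p + 1 ≤ Real.exp (3 * Real.pi / p) := Real.add_one_le_exp _
  have hexp_neg : ∀ x : ℝ, 0 ≤ x → Real.exp (-x) ≤ (1 + x)⁻¹ := by
    intro x hx
    rw [Real.exp_neg]
    exact inv_anti₀ (by linarith) (by linarith [Real.add_one_le_exp x])
  set q := Real.exp (-Real.pi / 2) with hq
  have hq0 : 0 < q := Real.exp_pos _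
  have hq1 : q ≤ 1 / 2 := by
    have := hexp_neg (Real.pi / 2) (by linarith)
    rw [hq, neg_div]
    refine this.trans ?_
    rw [inv_eq_one_div]
    exact one_div_le_one_div_of_le two_pos (by linarith)
  have h3 : q * (1 - q)⁻¹ ≤ 1 := by
    rw [← div_eq_mul_inv, div_le_one (by linarith)]
    linarith
  have h4 : Real.exp (-Real.pi * (p - 4) / 2) < 3 * Real.pi / p := by
    have := hexp_neg (Real.pi * (p - 4) / 2) (by nlinarith)
    rw [show -Real.pi * ((p : ℝ) - 4) / 2 = -(Real.pi * (p - 4) / 2) by ring]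
    refine this.trans_lt ?_
    have h6 : 3 / 2 * (p : ℝ) - 5 ≤ 1 + Real.pi * (p - 4) / 2 := by nlinarith
    have h7 : 9 * (3 / 2 * (p : ℝ) - 5) ≤ 3 * Real.pi * (1 + Real.pi * (p - 4) / 2) :=
      mul_le_mul (by linarith) h6 (by linarith) (by linarith)
    rw [inv_eq_one_div, div_lt_div_iff₀ (by linarith) (by linarith)]
    linarith
  rw [h1]
  refine mul_lt_mul_of_pos_left ?_ hpos
  have h5 : Real.exp (-Real.pi * (p - 4) / 2) * (q * (1 - q)⁻¹) ≤
      Real.exp (-Real.pi * (p - 4) / 2) := mul_le_of_le_one_right (Real.exp_pos _).le h3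
  linarith

/-- The theta coefficients in the residue classes `± 1` outweigh those in the classes `± 2`. -/
theorem tsum_even_ne_zero {p : ℕ} [Fact p.Prime] (hp : 5 ≤ p) :
    ∑' m : ℕ, thetaWeight p 0 (m + 1) * (signedEq 1 ((m + 1 : ℕ) : ZMod p) 1 -
      signedEq 1 ((m + 1 : ℕ) : ZMod p) 2) ≠ 0 := by
  set g : ℕ → ℝ := fun m => signedEq 1 ((m + 1 : ℕ) : ZMod p) 1 -
      signedEq 1 ((m + 1 : ℕ) : ZMod p) 2 with hg
  have hsum : Summable fun m => thetaWeight p 0 (m + 1) * g m := by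
    refine summable_thetaWeight_mul (C := 4) 0 fun m => ?_
    have h1 := abs_le.1 (abs_signedEq_le (Or.inl rfl) ((m + 1 : ℕ) : ZMod p) 1)
    have h2 := abs_le.1 (abs_signedEq_le (Or.inl rfl) ((m + 1 : ℕ) : ZMod p) 2)
    rw [abs_le]
    constructor <;> simp only [hg] <;> linarith [h1.1, h1.2, h2.1, h2.2]
  have hne : ∀ a b : ℕ, 0 < a + b → a + b < p → (a : ZMod p) ≠ -(b : ZMod p) := by
    intro a b h0 hlt h
    rw [eq_neg_iff_add_eq_zero] at h
    exact natCast_zmod_ne_zero h0 hlt (by exact_mod_cast h)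
  have hne' : ∀ a b : ℕ, a ≠ b → a < p → b < p → (a : ZMod p) ≠ (b : ZMod p) :=
    fun a b h h1 h2 => fun h' => h ((natCast_zmod_inj h1 h2).1 h')
  have hind : ∀ P : Prop, ∀ [Decidable P], (0 : ℝ) ≤ if P then 1 else 0 := by
    intro P _; split_ifs <;> norm_num
  have hind1 : ∀ P : Prop, ∀ [Decidable P], (if P then (1 : ℝ) else 0) ≤ 1 := by
    intro P _; split_ifs <;> norm_num
  have h22 : (2 : ZMod p) ≠ -2 := by
    simpa using hne 2 2 (by omega) (by omega)
  -- The classes `2` and `-2` are distinct, so each index is counted at most once.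
  have hge : ∀ m, -1 ≤ g m := by
    intro m
    have h1 := hind (((m + 1 : ℕ) : ZMod p) = 1)
    have h2 := hind (((m + 1 : ℕ) : ZMod p) = -1)
    simp only [hg, signedEq, one_mul]
    by_cases h : ((m + 1 : ℕ) : ZMod p) = 2
    · have h' : ((m + 1 : ℕ) : ZMod p) ≠ -2 := by rw [h]; exact h22
      rw [if_pos h, if_neg h']
      linarith
    · rw [if_neg h]
      linarith [hind1 (((m + 1 : ℕ) : ZMod p) = -2)]
  set E := Real.exp (-Real.pi * (p - 4) / 2)
  set q := Real.exp (-Real.pi / 2) with hq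
  have hq0 : 0 < q := Real.exp_pos _
  have hq1 : q < 1 := Real.exp_lt_one_iff.2 (by linarith [Real.pi_pos])
  have hterm : ∀ m : ℕ, -(thetaWeight p 0 2 * E * q) * q ^ m ≤
      thetaWeight p 0 (m + 2 + 1) * g (m + 2) := by
    intro m
    have hnn := thetaWeight_nonneg p 0 2
    by_cases h : p - 2 ≤ m + 2 + 1
    · have h1 := thetaWeight_even_tail_le (by omega) h (by omega)
      have h2 : thetaWeight p 0 (m + 2 + 1) * (-1) ≤ thetaWeight p 0 (m + 2 + 1) * g (m + 2) :=
        mul_le_mul_of_nonneg_left (hge _) (thetaWeight_nonneg _ _ _)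
      rw [show m + 2 + 1 - 2 = m + 1 by omega, pow_succ] at h1
      calc _ = -(thetaWeight p 0 2 * (E * (q ^ m * q))) := by ring
        _ ≤ thetaWeight p 0 (m + 2 + 1) * (-1) := by linarith
        _ ≤ _ := h2
    · have h3 : ((m + 2 + 1 : ℕ) : ZMod p) ≠ 2 := by
        simpa using hne' (m + 2 + 1) 2 (by omega) (by omega) (by omega)
      have h4 : ((m + 2 + 1 : ℕ) : ZMod p) ≠ -2 := by
        simpa using hne (m + 2 + 1) 2 (by omega) (by omega)
      have h5 : 0 ≤ g (m + 2) := by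
        simp only [hg, signedEq, one_mul]
        rw [if_neg h3, if_neg h4]
        linarith [hind (((m + 2 + 1 : ℕ) : ZMod p) = 1), hind (((m + 2 + 1 : ℕ) : ZMod p) = -1)]
      have h6 : 0 ≤ thetaWeight p 0 2 * E * q * q ^ m := by
        have : 0 < E := Real.exp_pos _
        positivity
      calc _ ≤ 0 := by linarith
        _ ≤ _ := mul_nonneg (thetaWeight_nonneg _ _ _) h5
  have hgeo : HasSum (fun m : ℕ => -(thetaWeight p 0 2 * E * q) * q ^ m)
      (-(thetaWeight p 0 2 * E * q) * (1 - q)⁻¹) :=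
    (hasSum_geometric_of_lt_one hq0.le hq1).mul_left _
  have htail : -(thetaWeight p 0 2 * E * q) * (1 - q)⁻¹ ≤
      ∑' m : ℕ, thetaWeight p 0 (m + 2 + 1) * g (m + 2) := by
    rw [← hgeo.tsum_eq]
    exact hgeo.summable.tsum_le_tsum hterm ((summable_nat_add_iff 2).2 hsum)
  have hg0 : g 0 = 1 := by
    have h1 : (1 : ZMod p) ≠ -1 := by simpa using hne 1 1 (by omega) (by omega)
    have h2 : (1 : ZMod p) ≠ 2 := by simpa using hne' 1 2 (by omega) (by omega) (by omega)
    have h3 : (1 : ZMod p) ≠ -2 := by simpa using hne 1 2 (by omega) (by omega)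
    simp [hg, signedEq, h1, h2, h3]
  have hg1 : -1 ≤ g 1 := hge 1
  rw [← hsum.sum_add_tsum_nat_add 2]
  simp only [sum_range_succ, sum_range_zero, zero_add, hg0, mul_one]
  have hbud := thetaWeight_two_add_tail_lt hp
  have h7 := mul_le_mul_of_nonneg_left hg1 (thetaWeight_nonneg p 0 2)
  refine ne_of_gt ?_
  have h8 : thetaWeight p 0 2 * (1 + E * (q * (1 - q)⁻¹)) =
      thetaWeight p 0 2 + thetaWeight p 0 2 * E * q * (1 - q)⁻¹ := by ring
  norm_num at h7 ⊢
  linarith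

/-- The theta coefficients in the residue class `1` outweigh those in the class `-1`. -/
theorem tsum_odd_ne_zero {p : ℕ} [Fact p.Prime] (hp : 3 ≤ p) :
    ∑' m : ℕ, thetaWeight p 1 (m + 1) * signedEq (-1) ((m + 1 : ℕ) : ZMod p) 1 ≠ 0 := by
  have hsum : Summable fun m : ℕ =>
      thetaWeight p 1 (m + 1) * signedEq (-1) ((m + 1 : ℕ) : ZMod p) 1 :=
    summable_thetaWeight_mul 1 fun m => abs_signedEq_le (Or.inr rfl) _ _
  set ρ := 2 * Real.exp (-Real.pi) with hρ
  have hρ0 : 0 < ρ := by positivity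
  have hρ1 : ρ < 1 / 2 := by
    have h1 : 4 < Real.exp Real.pi := by
      linarith [Real.add_one_le_exp Real.pi, Real.pi_gt_three]
    rw [hρ, Real.exp_neg, ← div_eq_mul_inv, div_lt_div_iff₀ (Real.exp_pos _) two_pos]
    linarith
  have hpos : 0 < thetaWeight p 1 1 := by simp only [thetaWeight]; positivity
  have hterm : ∀ m : ℕ, -(thetaWeight p 1 1 * ρ) * ρ ^ m ≤
      thetaWeight p 1 (m + 1 + 1) * signedEq (-1) ((m + 1 + 1 : ℕ) : ZMod p) 1 := by
    intro m
    have h0 : 0 ≤ thetaWeight p 1 1 * ρ * ρ ^ m := by positivity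
    by_cases h : p - 1 ≤ m + 1 + 1
    · have h1 := thetaWeight_odd_tail_le (by omega) h (by omega)
      have h2 : -1 ≤ signedEq (-1) ((m + 1 + 1 : ℕ) : ZMod p) 1 := by
        unfold signedEq
        split_ifs <;> norm_num
      have h3 := mul_le_mul_of_nonneg_left h2 (thetaWeight_nonneg p 1 (m + 1 + 1))
      rw [show m + 1 + 1 - 1 = m + 1 by omega, pow_succ] at h1
      calc _ = -(thetaWeight p 1 1 * (ρ ^ m * ρ)) := by ring
        _ ≤ thetaWeight p 1 (m + 1 + 1) * (-1) := by linarith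
        _ ≤ _ := h3
    · have h4 : ((m + 1 + 1 : ℕ) : ZMod p) ≠ -1 := by
        intro h5
        rw [eq_neg_iff_add_eq_zero] at h5
        exact natCast_zmod_ne_zero (p := p) (a := m + 1 + 1 + 1) (by omega) (by omega)
          (by exact_mod_cast h5)
      have h5 : 0 ≤ signedEq (-1) ((m + 1 + 1 : ℕ) : ZMod p) 1 := by
        unfold signedEq
        rw [if_neg h4]
        split_ifs <;> norm_num
      calc _ ≤ 0 := by linarith
        _ ≤ _ := mul_nonneg (thetaWeight_nonneg _ _ _) h5
  have hgeo : HasSum (fun m : ℕ => -(thetaWeight p 1 1 * ρ) * ρ ^ m)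
      (-(thetaWeight p 1 1 * ρ) * (1 - ρ)⁻¹) :=
    (hasSum_geometric_of_lt_one hρ0.le (by linarith)).mul_left _
  have htail : -(thetaWeight p 1 1 * ρ) * (1 - ρ)⁻¹ ≤ ∑' m : ℕ,
      thetaWeight p 1 (m + 1 + 1) * signedEq (-1) ((m + 1 + 1 : ℕ) : ZMod p) 1 := by
    rw [← hgeo.tsum_eq]
    exact hgeo.summable.tsum_le_tsum hterm ((summable_nat_add_iff 1).2 hsum)
  have h1 : (1 : ZMod p) ≠ -1 := by
    intro h5
    rw [eq_neg_iff_add_eq_zero] at h5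
    exact natCast_zmod_ne_zero (p := p) (a := 2) (by omega) (by omega)
      (by norm_num at h5 ⊢; exact h5)
  rw [hsum.tsum_eq_zero_add]
  have h2 : signedEq (p := p) (-1) ((0 + 1 : ℕ) : ZMod p) 1 = 1 := by simp [signedEq, h1]
  rw [h2, mul_one]
  have h3 : ρ * (1 - ρ)⁻¹ < 1 := by
    rw [← div_eq_mul_inv, div_lt_one (by linarith)]
    linarith
  have h4 := mul_lt_mul_of_pos_left h3 hpos
  refine ne_of_gt ?_
  rw [zero_add]
  linarith

theorem prime_sub_one_div_two_ne_zero {p : ℕ} (hp : 3 ≤ p) : ((p : ℝ) - 1) / 2 ≠ 0 := by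
  have : (3 : ℝ) ≤ p := by exact_mod_cast hp
  have : 0 < ((p : ℝ) - 1) / 2 := by linarith
  exact this.ne'

/-- If the theta function vanished at all even nonprincipal characters, orthogonality would make the
total weights of the residue classes `± 1` and `± 2` equal. -/
theorem evenThetaMoment_pos (k : ℕ) {p : ℕ} [Fact p.Prime] (hp : 5 ≤ p) :
    0 < evenThetaMoment k p := by
  refine lt_of_le_of_ne (evenThetaMoment_nonneg k p) fun h => ?_
  rw [evenThetaMoment_eq, eq_comm, sum_eq_zero_iff_of_nonneg fun _ _ => by positivity] at h
  have h12 : ∀ s ∈ (univ : Finset (Fin 2)), (![1, 2] : Fin 2 → ZMod p) s ≠ 0 := by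
    intro s _
    fin_cases s
    · simp
    · simpa using natCast_zmod_ne_zero (p := p) (a := 2) (by omega) (by omega)
  have hpair := sum_thetaSeries_mul_char_poly (p := p) 0 (ε := 1) (Or.inl rfl)
    (univ : Finset (Fin 2)) (fun _ => 1) h12 ![1, -1]
  rw [sum_eq_zero] at hpair
  · simp only [Fin.sum_univ_two, mul_one] at hpair
    have h0 := (mul_eq_zero.1 (Complex.ofReal_eq_zero.1 hpair.symm)).resolve_left
      (prime_sub_one_div_two_ne_zero (by omega))
    refine tsum_even_ne_zero hp (Eq.trans (tsum_congr fun m => ?_) h0)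
    simp only [Matrix.cons_val_zero, Matrix.cons_val_one]
    ring
  -- The principal character is orthogonal to the test polynomial `conj χ(1) - conj χ(2)`.
  · intro χ hχ
    by_cases h1 : χ = 1
    · subst h1
      have h2 : (1 : DirichletCharacter ℂ p) 2 = 1 :=
        MulChar.one_apply (IsUnit.mk0 _ (by simpa using h12 1 (mem_univ 1)))
      simp [Fin.sum_univ_two, h2]
    · have h3 := h χ (mem_erase.2 ⟨h1, hχ⟩)
      rw [norm_eq_zero.1 (eq_zero_of_pow_eq_zero h3), zero_mul]

/-- If the theta function vanished at all odd characters, orthogonality would make the total weights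
of the residue classes `1` and `-1` equal. -/
theorem oddThetaMoment_pos (k : ℕ) {p : ℕ} [Fact p.Prime] (hp : 3 ≤ p) :
    0 < oddThetaMoment k p := by
  refine lt_of_le_of_ne (oddThetaMoment_nonneg k p) fun h => ?_
  rw [oddThetaMoment_eq, eq_comm, sum_eq_zero_iff_of_nonneg fun _ _ => by positivity] at h
  have hpair := sum_thetaSeries_mul_char_poly (p := p) 1 (ε := -1) (Or.inr rfl)
    ({0} : Finset ℕ) (fun _ => 1) (v := fun _ => 1) (fun _ _ => one_ne_zero) fun _ => 1
  rw [sum_eq_zero] at hpair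
  · simp only [sum_singleton, mul_one, one_mul] at hpair
    have h0 := (mul_eq_zero.1 (Complex.ofReal_eq_zero.1 hpair.symm)).resolve_left
      (prime_sub_one_div_two_ne_zero (by omega))
    exact tsum_odd_ne_zero hp h0
  · intro χ hχ
    rw [norm_eq_zero.1 (eq_zero_of_pow_eq_zero (h χ hχ)), zero_mul]

/-! ### The mixed moment -/

/-- The character polynomial with coefficients `h`, of length `X`. -/
noncomputable def resonator {p : ℕ} (h : ℕ → ℝ) (X : ℕ) (χ : DirichletCharacter ℂ p) : ℂ :=
  ∑ v ∈ Icc 1 X, (h v : ℂ) * χ (v : ZMod p)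

/-- The sum of `h v` over the solutions of `u * ∏ aᵢ = v` modulo `p` with `aᵢ ≤ y` and `v ≤ X`. -/
def congruenceSum {p : ℕ} (h : ℕ → ℝ) (n y X : ℕ) (u : ZMod p) : ℝ :=
  ∑ s ∈ tupleBox n y ×ˢ Icc 1 X, h s.2 * if u * ((∏ i, s.1 i : ℕ) : ZMod p) = s.2 then 1 else 0

theorem charSum_pow_mul_conj_resonator {p : ℕ} (h : ℕ → ℝ) (n y X : ℕ)
    (χ : DirichletCharacter ℂ p) :
    charSum p y χ ^ n * conj (resonator h X χ) = ∑ s ∈ tupleBox n y ×ˢ Icc 1 X,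
      (h s.2 : ℂ) * (χ ((∏ i, s.1 i : ℕ) : ZMod p) * conj (χ (s.2 : ZMod p))) := by
  rw [charSum_pow, resonator, map_sum, sum_mul_sum, sum_product]
  refine sum_congr rfl fun a _ => sum_congr rfl fun v _ => ?_
  rw [map_mul, Complex.conj_ofReal]
  ring

theorem congruenceSum_nonneg {p : ℕ} {h : ℕ → ℝ} (hh : ∀ v, 0 ≤ h v) (n y X : ℕ) (u : ZMod p) :
    0 ≤ congruenceSum h n y X u :=
  sum_nonneg fun s _ => mul_nonneg (hh _) (by split_ifs <;> norm_num)

theorem congruenceSum_le {p : ℕ} {h : ℕ → ℝ} (hh : ∀ v, 0 ≤ h v) (n y X : ℕ) (u : ZMod p) :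
    congruenceSum h n y X u ≤ (y : ℝ) ^ n * ∑ v ∈ Icc 1 X, h v := by
  calc congruenceSum h n y X u ≤ ∑ s ∈ tupleBox n y ×ˢ Icc 1 X, h s.2 :=
        sum_le_sum fun s _ => mul_le_of_le_one_right (hh _) (by split_ifs <;> norm_num)
    _ = _ := by
        simp only [sum_product, sum_const, nsmul_eq_mul, Fintype.card_piFinset]
        simp

theorem sum_mul_signedEq {p : ℕ} (h : ℕ → ℝ) (n y X : ℕ) (ε : ℝ) (u : ZMod p) :
    ∑ s ∈ tupleBox n y ×ˢ Icc 1 X, h s.2 * signedEq ε (u * ((∏ i, s.1 i : ℕ) : ZMod p)) s.2 =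
      congruenceSum h n y X u + ε * congruenceSum h n y X (-u) := by
  unfold congruenceSum signedEq
  rw [mul_sum, ← sum_add_distrib]
  refine sum_congr rfl fun s _ => ?_
  simp only [neg_mul, neg_eq_iff_eq_neg]
  ring

theorem summable_thetaWeight_mul_congruenceSum {p : ℕ} [NeZero p] (η : ℕ) {h : ℕ → ℝ}
    (hh : ∀ v, 0 ≤ h v) (n y X : ℕ) (f : ℕ → ZMod p) :
    Summable fun m : ℕ => thetaWeight p η (m + 1) * congruenceSum h n y X (f m) :=
  summable_thetaWeight_mul η fun m => by
    rw [abs_of_nonneg (congruenceSum_nonneg hh _ _ _ _)]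
    exact congruenceSum_le hh _ _ _ _

/-- The mixed moment of the theta series, the short character sum and the resonator. -/
theorem sum_thetaSeries_mul_resonator {p : ℕ} [Fact p.Prime] (η : ℕ) {ε : ℝ}
    (hε : ε = 1 ∨ ε = -1) {h : ℕ → ℝ} (hh : ∀ v, 0 ≤ h v) (n y : ℕ) {X : ℕ} (hX : X < p) :
    ∑ χ : DirichletCharacter ℂ p with χ (-1) = (ε : ℂ),
        thetaSeries p η 1 χ * (charSum p y χ ^ n * conj (resonator h X χ)) =
      (((p - 1) / 2 *
        (∑' m : ℕ, thetaWeight p η (m + 1) * congruenceSum h n y X ((m + 1 : ℕ) : ZMod p) +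
        ε * ∑' m : ℕ, thetaWeight p η (m + 1) *
          congruenceSum h n y X (-((m + 1 : ℕ) : ZMod p))) : ℝ) : ℂ) := by
  simp only [charSum_pow_mul_conj_resonator]
  rw [sum_thetaSeries_mul_char_poly η hε (tupleBox n y ×ˢ Icc 1 X)
    (fun s => ((∏ i, s.1 i : ℕ) : ZMod p)) (v := fun s => (s.2 : ZMod p)) (fun s hs => by
      have := mem_Icc.1 (mem_product.1 hs).2
      exact natCast_zmod_ne_zero this.1 (this.2.trans_lt hX)) fun s => h s.2]
  congr 2
  rw [← tsum_mul_left, ← (summable_thetaWeight_mul_congruenceSum η hh n y X _).tsum_add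
    ((summable_thetaWeight_mul_congruenceSum η hh n y X _).mul_left ε)]
  refine tsum_congr fun m => ?_
  rw [sum_mul_signedEq]
  ring

theorem sum_le_tsum_succ {F : ℕ → ℝ} (hF : ∀ m, 0 ≤ F m) (hs : Summable fun m => F (m + 1))
    {S : Finset ℕ} (hS : ∀ m ∈ S, 1 ≤ m) : ∑ m ∈ S, F m ≤ ∑' m, F (m + 1) := by
  have h1 : ∑ m ∈ S, F m = ∑ m ∈ S.image (· - 1), F (m + 1) := by
    rw [sum_image]
    · exact sum_congr rfl fun m hm => by rw [Nat.sub_add_cancel (hS m hm)]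
    · intro a ha b hb hab
      have := hS a ha
      have := hS b hb
      simp only at hab
      omega
  rw [h1]
  exact hs.sum_le_tsum _ fun m _ => hF _

theorem prod_roughWeight_le (k Q : ℕ) {n : ℕ} {a : Fin n → ℕ} (ha : ∀ i, a i ≠ 0) :
    ∏ i, roughWeight k Q (a i) ≤ roughWeight k Q (∏ i, a i) := by
  induction n with
  | zero => simp [roughWeight, Nat.ModEq.refl]
  | succ n ih =>
    rw [Fin.prod_univ_succ, Fin.prod_univ_succ]
    refine le_trans ?_ (roughWeight_mul_le k Q (ha 0) (prod_ne_zero_iff.2 fun i _ => ha i.succ))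
    exact mul_le_mul_of_nonneg_left (ih fun i => ha i.succ) (roughWeight_nonneg _ _ _)

theorem mul_pow_le_congruenceSum {p : ℕ} (k Q n y : ℕ) {N m : ℕ} (hm : 1 ≤ m) (hmN : m ≤ N) :
    roughWeight k Q m * (∑ a ∈ Icc 1 y, roughWeight k Q a) ^ n ≤
      congruenceSum (p := p) (roughWeight k Q) n y (N * y ^ n) (m : ZMod p) := by
  rw [sum_pow', mul_sum, congruenceSum, sum_product]
  refine sum_le_sum fun a ha => ?_
  have hab := prod_mem_Icc_of_mem_tupleBox ha
  have ha0 : ∀ i, a i ≠ 0 := fun i =>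
    Nat.one_le_iff_ne_zero.1 (mem_Icc.1 (Fintype.mem_piFinset.1 ha i)).1
  have hmem : m * ∏ i, a i ∈ Icc 1 (N * y ^ n) :=
    mem_Icc.2 ⟨Nat.mul_pos hm hab.1, Nat.mul_le_mul hmN hab.2⟩
  refine le_trans ?_ (single_le_sum (f := fun v => roughWeight k Q v *
    if (m : ZMod p) * ((∏ i, a i : ℕ) : ZMod p) = (v : ZMod p) then 1 else 0)
    (fun v _ => mul_nonneg (roughWeight_nonneg _ _ _) (by split_ifs <;> norm_num)) hmem)
  rw [if_pos (Nat.cast_mul _ _).symm, mul_one]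
  refine le_trans ?_ (roughWeight_mul_le k Q (Nat.one_le_iff_ne_zero.1 hm)
    (Nat.one_le_iff_ne_zero.1 hab.1))
  exact mul_le_mul_of_nonneg_left (prod_roughWeight_le k Q ha0) (roughWeight_nonneg _ _ _)

theorem thetaWeight_ge {p η N m : ℕ} (hp : 0 < p) (hN : N ^ 2 ≤ p) (hm : (N : ℝ) / 2 < m)
    (hmN : m ≤ N) : Real.exp (-Real.pi) * ((N : ℝ) / 2) ^ η ≤ thetaWeight p η m := by
  have hp' : (0 : ℝ) < p := by exact_mod_cast hp
  have h1 : (m : ℝ) ^ 2 ≤ p := by exact_mod_cast (Nat.pow_le_pow_left hmN 2).trans hN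
  have h2 : -Real.pi ≤ -Real.pi * (m : ℝ) ^ 2 / p := by
    rw [le_div_iff₀ hp']
    nlinarith [Real.pi_pos]
  rw [mul_comm]
  unfold thetaWeight
  gcongr

/-- The diagonal solutions `v = m * ∏ aᵢ` of the congruence give the main term. -/
theorem main_term_le_tsum {p : ℕ} [NeZero p] (η k Q n y : ℕ) {N : ℕ} (hN : N ^ 2 ≤ p) :
    Real.exp (-Real.pi) * ((N : ℝ) / 2) ^ η *
        ((∑ m ∈ Icc 1 N with (N : ℝ) / 2 < ((m : ℕ) : ℝ), roughWeight k Q m) *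
          (∑ a ∈ Icc 1 y, roughWeight k Q a) ^ n) ≤
      ∑' m : ℕ, thetaWeight p η (m + 1) *
        congruenceSum (roughWeight k Q) n y (N * y ^ n) ((m + 1 : ℕ) : ZMod p) := by
  have hh := roughWeight_nonneg k Q
  refine le_trans ?_ (sum_le_tsum_succ (F := fun m => thetaWeight p η m *
    congruenceSum (roughWeight k Q) n y (N * y ^ n) (m : ZMod p))
    (fun m => mul_nonneg (thetaWeight_nonneg _ _ _) (congruenceSum_nonneg hh _ _ _ _))
    (summable_thetaWeight_mul_congruenceSum η hh n y _ _)
    (S := {m ∈ Icc 1 N | (N : ℝ) / 2 < ((m : ℕ) : ℝ)})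
    fun m hm => (mem_Icc.1 (mem_filter.1 hm).1).1)
  rw [sum_mul, mul_sum]
  refine sum_le_sum fun m hm => ?_
  obtain ⟨hm, hm'⟩ := mem_filter.1 hm
  rw [mem_Icc] at hm
  exact mul_le_mul (thetaWeight_ge (Nat.pos_of_ne_zero (NeZero.ne p)) hN hm' hm.2)
    (mul_pow_le_congruenceSum k Q n y hm.1 hm.2)
    (mul_nonneg (hh _) (pow_nonneg (sum_nonneg fun a _ => hh a) _)) (thetaWeight_nonneg _ _ _)

/-- A crude bound for the theta series of the principal character, of smaller order than `p`. -/
theorem tsum_thetaWeight_even_le (p : ℕ) [NeZero p] :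
    ∑' m : ℕ, thetaWeight p 0 (m + 1) ≤
      (p : ℝ) ^ (3 / 4 : ℝ) * ∑' m : ℕ, 1 / ((m + 1 : ℕ) : ℝ) ^ (3 / 2 : ℝ) := by
  have hp : (0 : ℝ) < p := by exact_mod_cast Nat.pos_of_ne_zero (NeZero.ne p)
  have hsum : Summable fun m : ℕ => 1 / ((m + 1 : ℕ) : ℝ) ^ (3 / 2 : ℝ) :=
    (summable_nat_add_iff 1).2 (Real.summable_one_div_nat_rpow.2 (by norm_num))
  rw [← tsum_mul_left]
  refine (summable_thetaWeight p 0).tsum_le_tsum (fun m => ?_) (hsum.mul_left _)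
  set x : ℝ := ((m + 1 : ℕ) : ℝ)
  have hx : 0 < x := by positivity
  have h1 : Real.exp (-Real.pi * x ^ 2 / p) ≤ (x ^ 2 / p) ^ (-(3 / 4) : ℝ) := by
    rw [Real.rpow_def_of_pos (by positivity), Real.exp_le_exp]
    have h2 := Real.log_le_sub_one_of_pos (show 0 < x ^ 2 / p by positivity)
    have h3 : -Real.pi * x ^ 2 / p = -(Real.pi * (x ^ 2 / p)) := by ring
    have h4 : 0 < x ^ 2 / p := by positivity
    rw [h3]
    nlinarith [Real.pi_gt_three]
  calc thetaWeight p 0 (m + 1) = Real.exp (-Real.pi * x ^ 2 / p) := by simp [thetaWeight, x]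
    _ ≤ _ := h1
    _ = _ := by
        rw [Real.div_rpow (by positivity) hp.le, ← Real.rpow_natCast x 2, ← Real.rpow_mul hx.le,
          Real.rpow_neg hp.le, div_inv_eq_mul, mul_comm, one_div, ← Real.rpow_neg hx.le]
        norm_num

open Filter

theorem congruenceSum_neg_eq_zero {p : ℕ} (h : ℕ → ℝ) {n y X m : ℕ} (hlt : m * y ^ n + X < p) :
    congruenceSum h n y X (-(m : ZMod p)) = 0 := by
  refine sum_eq_zero fun s hs => ?_
  obtain ⟨ha, hv⟩ := mem_product.1 hs
  have hab := prod_mem_Icc_of_mem_tupleBox ha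
  rw [mem_Icc] at hv
  rw [if_neg, mul_zero]
  intro heq
  have h0 : ((m * ∏ i, s.1 i + s.2 : ℕ) : ZMod p) = 0 := by
    rw [Nat.cast_add, ← heq, Nat.cast_mul]
    ring
  refine natCast_zmod_ne_zero (hv.1.trans (Nat.le_add_left _ _)) (lt_of_le_of_lt ?_ hlt) h0
  exact Nat.add_le_add (Nat.mul_le_mul_left _ hab.2) hv.2

/-- For odd characters, the solutions of `m * ∏ aᵢ = -v` require `m` to be much larger than `√p`,
where the theta coefficients are negligible. -/
theorem tsum_odd_error_le {p : ℕ} [NeZero p] {h : ℕ → ℝ} (hh : ∀ v, 0 ≤ h v)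
    (hhv : ∀ v : ℕ, 1 ≤ v → h v ≤ v) {n y X : ℕ} (hy : (y ^ n) ^ 8 ≤ p) (hX : X ^ 8 ≤ p ^ 5)
    (h2X : 2 * X ≤ p) :
    ∑' m : ℕ, thetaWeight p 1 (m + 1) * congruenceSum h n y X (-((m + 1 : ℕ) : ZMod p)) ≤
      (5040 * 256 * 8) * ∑' m : ℕ, 1 / ((m + 1 : ℕ) : ℝ) ^ 2 := by
  have hp0 : 1 ≤ p := Nat.pos_of_ne_zero (NeZero.ne p)
  have hp : (0 : ℝ) < p := by exact_mod_cast hp0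
  have hsum : Summable fun m : ℕ => 1 / ((m + 1 : ℕ) : ℝ) ^ 2 :=
    (summable_nat_add_iff (f := fun m : ℕ => 1 / (m : ℝ) ^ 2) 1).2
      (Real.summable_one_div_nat_pow.2 (by norm_num))
  have hyX : y ^ n * X ≤ p := by
    refine le_of_pow_le_pow_left₀ (n := 8) (by norm_num) (Nat.zero_le _) ?_
    calc (y ^ n * X) ^ 8 = (y ^ n) ^ 8 * X ^ 8 := mul_pow _ _ _
      _ ≤ p * p ^ 5 := Nat.mul_le_mul hy hX
      _ = p ^ 6 := by ring
      _ ≤ p ^ 8 := Nat.pow_le_pow_right hp0 (by norm_num)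
  have hcs : ∀ u : ZMod p, congruenceSum h n y X u ≤ (p : ℝ) ^ 2 := by
    intro u
    refine (congruenceSum_le hh n y X u).trans ?_
    have h1 : ∑ v ∈ Icc 1 X, h v ≤ (X : ℝ) * X := by
      calc ∑ v ∈ Icc 1 X, h v ≤ ∑ _v ∈ Icc 1 X, (X : ℝ) := sum_le_sum fun v hv => by
            rw [mem_Icc] at hv
            exact (hhv v hv.1).trans (by exact_mod_cast hv.2)
        _ = _ := by simp
    calc (y : ℝ) ^ n * ∑ v ∈ Icc 1 X, h v ≤ (y : ℝ) ^ n * (X * X) := by gcongr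
      _ = ((y ^ n * X : ℕ) : ℝ) * X := by push_cast; ring
      _ ≤ (p : ℝ) * p := by
          gcongr
          omega
      _ = _ := by ring
  rw [← tsum_mul_left]
  refine (summable_thetaWeight_mul_congruenceSum 1 hh n y X _).tsum_le_tsum (fun m => ?_)
    (hsum.mul_left _)
  set x : ℝ := ((m + 1 : ℕ) : ℝ) with hx
  have hx0 : 0 < x := by positivity
  by_cases hlt : (m + 1) * y ^ n + X < p
  · rw [congruenceSum_neg_eq_zero h hlt, mul_zero]
    positivity
  -- Here `x = m + 1` is at least about `p ^ (7 / 8)`, so that powers of `p` can be traded for powers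
  -- of `x`, and `exp (-u) ≤ 7! / u ^ 7` with `u = x ^ 2 / p` suffices.
  · have h1 : p ≤ 2 * ((m + 1) * y ^ n) := by omega
    have h2 : p ^ 7 ≤ (2 * (m + 1)) ^ 8 := by
      refine Nat.le_of_mul_le_mul_right ?_ hp0
      calc p ^ 7 * p = p ^ 8 := by ring
        _ ≤ (2 * ((m + 1) * y ^ n)) ^ 8 := Nat.pow_le_pow_left h1 8
        _ = (2 * (m + 1)) ^ 8 * (y ^ n) ^ 8 := by ring
        _ ≤ _ := Nat.mul_le_mul_left _ hy
    have h3 : p ^ 2 ≤ (2 * (m + 1)) ^ 3 := by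
      refine le_of_pow_le_pow_left₀ (n := 7) (by norm_num) (Nat.zero_le _) ?_
      calc (p ^ 2) ^ 7 = (p ^ 7) ^ 2 := by ring
        _ ≤ ((2 * (m + 1)) ^ 8) ^ 2 := Nat.pow_le_pow_left h2 2
        _ = (2 * (m + 1)) ^ 16 := by ring
        _ ≤ (2 * (m + 1)) ^ 21 := Nat.pow_le_pow_right (by omega) (by norm_num)
        _ = _ := by ring
    have h2' : (p : ℝ) ^ 7 ≤ 256 * x ^ 8 := by
      have : (p : ℝ) ^ 7 ≤ (2 * x) ^ 8 := by rw [hx]; exact_mod_cast h2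
      calc _ ≤ _ := this
        _ = _ := by ring
    have h3' : (p : ℝ) ^ 2 ≤ 8 * x ^ 3 := by
      have : (p : ℝ) ^ 2 ≤ (2 * x) ^ 3 := by rw [hx]; exact_mod_cast h3
      calc _ ≤ _ := this
        _ = _ := by ring
    have h4 : Real.exp (-Real.pi * x ^ 2 / p) ≤ 5040 * 256 / x ^ 6 := by
      set u := x ^ 2 / p with hu
      have hu0 : 0 < u := by positivity
      have h5 : -Real.pi * x ^ 2 / p ≤ -u := by
        have : -Real.pi * x ^ 2 / p = -(Real.pi * u) := by rw [hu]; ring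
        rw [this]
        nlinarith [Real.pi_gt_three]
      have h6 := Real.pow_div_factorial_le_exp u hu0.le 7
      have h7 : ((Nat.factorial 7 : ℕ) : ℝ) = 5040 := by norm_num [Nat.factorial]
      rw [h7] at h6
      calc Real.exp (-Real.pi * x ^ 2 / p) ≤ Real.exp (-u) := Real.exp_le_exp.2 h5
        _ = (Real.exp u)⁻¹ := Real.exp_neg u
        _ ≤ (u ^ 7 / 5040)⁻¹ := inv_anti₀ (by positivity) h6
        _ = 5040 * p ^ 7 / x ^ 14 := by rw [hu]; field_simp
        _ ≤ 5040 * (256 * x ^ 8) / x ^ 14 := by gcongr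
        _ = _ := by field_simp
    calc thetaWeight p 1 (m + 1) * congruenceSum h n y X (-((m + 1 : ℕ) : ZMod p))
        ≤ (x * (5040 * 256 / x ^ 6)) * (8 * x ^ 3) := by
          refine mul_le_mul ?_ ((hcs _).trans h3') (congruenceSum_nonneg hh _ _ _ _)
            (by positivity)
          rw [thetaWeight, pow_one]
          exact mul_le_mul_of_nonneg_left h4 hx0.le
      _ = _ := by field_simp

theorem roughWeight_le_self (k : ℕ) {v : ℕ} (hv : 1 ≤ v) :
    roughWeight k ((k ^ 2) ^ 4).factorial v ≤ v := by
  unfold roughWeight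
  split_ifs with h
  · have h1 := pow_cardFactors_le_of_coprime_factorial ((k ^ 2) ^ 4)
      (Nat.one_le_iff_ne_zero.1 hv) (coprime_of_modEq_one h)
    have h2 : k ≤ (k ^ 2) ^ 4 := by
      rw [← pow_mul]; exact Nat.le_self_pow (by norm_num) k
    exact_mod_cast (Nat.pow_le_pow_left h2 _).trans h1
  · positivity

theorem eventually_log_nthRoot_ge {m : ℕ} (hm : m ≠ 0) :
    ∀ᶠ p : ℕ in atTop, Real.log p / (2 * m) ≤ Real.log (Nat.nthRoot m p) := by
  have hlog : Tendsto (fun p : ℕ => Real.log p) atTop atTop :=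
    Real.tendsto_log_atTop.comp tendsto_natCast_atTop_atTop
  filter_upwards [hlog.eventually_ge_atTop (2 * m * Real.log 2), eventually_ge_atTop 1]
    with p hp hp1
  have hm' : (0 : ℝ) < m := by exact_mod_cast Nat.pos_of_ne_zero hm
  set r := Nat.nthRoot m p
  have hr : 1 ≤ r := (Nat.le_nthRoot_iff hm).2 (by simpa using hp1)
  have hr' : (1 : ℝ) ≤ r := by exact_mod_cast hr
  have h1 : (p : ℝ) ≤ (2 * r) ^ m := by
    have h2 := (Nat.lt_pow_nthRoot_add_one hm p).le
    have h3 : (r + 1) ^ m ≤ (2 * r) ^ m := Nat.pow_le_pow_left (by omega) m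
    exact_mod_cast h2.trans h3
  have h4 := Real.log_le_log (by exact_mod_cast hp1) h1
  rw [Real.log_pow, Real.log_mul two_ne_zero (by positivity)] at h4
  rw [div_le_iff₀ (by positivity)]
  nlinarith

theorem exists_eventually_sum_roughWeight_ge (n : ℕ) {Q m : ℕ} (hQ : 0 < Q) (hm : m ≠ 0) :
    ∃ c : ℝ, 0 < c ∧ ∀ᶠ p : ℕ in atTop, c * (Nat.nthRoot m p * Real.log p ^ n) ≤
      ∑ a ∈ Icc 1 (Nat.nthRoot m p) with ((Nat.nthRoot m p : ℕ) : ℝ) / 2 < ((a : ℕ) : ℝ),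
        roughWeight (n + 1) Q a := by
  obtain ⟨c, M₀, hc, hM₀, h⟩ := exists_sum_roughWeight_ge n hQ
  have hm' : (0 : ℝ) < m := by exact_mod_cast Nat.pos_of_ne_zero hm
  refine ⟨c / (2 * m) ^ n, by positivity, ?_⟩
  filter_upwards [eventually_log_nthRoot_ge hm, eventually_ge_atTop (⌈M₀⌉₊ ^ m)] with p hp1 hp2
  have h1 : M₀ ≤ Nat.nthRoot m p :=
    (Nat.le_ceil _).trans (by exact_mod_cast (Nat.le_nthRoot_iff hm).2 hp2)
  have h2 := h _ h1
  rw [Nat.floor_natCast] at h2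
  refine le_trans ?_ h2
  have h3 := Real.log_natCast_nonneg p
  calc c / (2 * m) ^ n * (Nat.nthRoot m p * Real.log p ^ n)
      = c * (Nat.nthRoot m p * (Real.log p / (2 * m)) ^ n) := by rw [div_pow]; ring
    _ ≤ _ := by gcongr

/-! ### Lower bounds for large primes -/

theorem sum_norm_resonator_sq_le {p : ℕ} [Fact p.Prime] (h : ℕ → ℝ) {X : ℕ} (hX : X < p) :
    ∑ χ : DirichletCharacter ℂ p, ‖resonator h X χ‖ ^ 2 ≤ p * ∑ v ∈ Icc 1 X, h v ^ 2 := by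
  have h1 := sum_norm_sq_char_poly (p := p) (Icc 1 X) (α := fun v => v)
    (fun v hv => ⟨(mem_Icc.1 hv).1, (mem_Icc.1 hv).2.trans_lt hX⟩) h
  simp only [resonator]
  rw [h1]
  have h2 : ∑ s ∈ Icc 1 X, ∑ t ∈ Icc 1 X, (if s = t then h s * h t else 0) =
      ∑ v ∈ Icc 1 X, h v ^ 2 := by
    refine sum_congr rfl fun s hs => ?_
    rw [sum_ite_eq, if_pos hs, sq]
  rw [h2]
  exact mul_le_mul_of_nonneg_right (by linarith) (sum_nonneg fun _ _ => sq_nonneg _)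

/-- A lower bound for the mixed moment with the short character sum and the resonator yields, by
Hölder's inequality, a lower bound for the high moment. The powers of `y` cancel, and the exponent
of the logarithm becomes `2 * n * (n + 1) ^ 2 - n ^ 3 - (n + 1) * (n ^ 2 + 2 * n) = n ^ 2`. -/
theorem moment_ge_of_mixed_moment_ge {n : ℕ} {c C : ℝ} (hc : 0 < c) (hC : 0 < C) {p : ℕ}
    [Fact p.Prime] {N y η : ℕ} {h : ℕ → ℝ} {S : Finset (DirichletCharacter ℂ p)}
    {Θ : DirichletCharacter ℂ p → ℂ} (hlog : 1 ≤ Real.log p) (hN : 1 ≤ N) (hy : 1 ≤ y)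
    (hyp : y ^ (n + 1) < p) (hX : N * y ^ n < p)
    (hH : ∑ v ∈ Icc 1 (N * y ^ n), h v ^ 2 ≤
      C * (((N * y ^ n : ℕ) : ℝ) * Real.log p ^ (n ^ 2 + 2 * n)))
    (hmix : c * (p * (N : ℝ) ^ η * ((N * y ^ n : ℕ) : ℝ) * Real.log p ^ (n * (n + 1))) ≤
      ‖∑ χ ∈ S, Θ χ * (charSum p y χ ^ n * conj (resonator h (N * y ^ n) χ))‖) :
    c ^ (2 * (n + 1)) / ((8 ^ n * 2 ^ n ^ 2) ^ n * C ^ (n + 1)) *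
        (p * (N : ℝ) ^ ((n + 1) * (1 + 2 * η)) * Real.log p ^ n ^ 2) ≤
      ∑ χ ∈ S, ‖Θ χ‖ ^ (2 * (n + 1)) := by
  set L := Real.log p
  set X := N * y ^ n with hXdef
  have hp0 : (0 : ℝ) < p := by exact_mod_cast (Fact.out : p.Prime).pos
  have hN0 : (0 : ℝ) < N := by exact_mod_cast hN
  have hy0 : (0 : ℝ) < y := by exact_mod_cast hy
  have hL0 : 0 < L := by linarith
  have hX0 : (0 : ℝ) < X := by rw [hXdef]; push_cast; positivity
  set P₁ := (p : ℝ) * (y : ℝ) ^ (n + 1) * L ^ n ^ 2 with hP₁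
  set P₂ := (p : ℝ) * X * L ^ (n ^ 2 + 2 * n) with hP₂
  have hA : ∑ χ ∈ S, ‖charSum p y χ‖ ^ (2 * (n + 1)) ≤ (8 ^ n * 2 ^ n ^ 2) * P₁ := by
    have hlogy : 1 + Real.log y ≤ 2 * L := by
      have : Real.log y ≤ L := Real.log_le_log hy0 (by
        exact_mod_cast (Nat.le_self_pow (Nat.succ_ne_zero n) y).trans hyp.le)
      linarith
    have hlogy0 : 0 ≤ Real.log y := Real.log_natCast_nonneg y
    calc ∑ χ ∈ S, ‖charSum p y χ‖ ^ (2 * (n + 1))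
        ≤ ∑ χ, ‖charSum p y χ‖ ^ (2 * (n + 1)) :=
          sum_le_sum_of_subset_of_nonneg (subset_univ _) fun _ _ _ => by positivity
      _ = (p - 1) * (multiplicativeEnergy (n + 1) y : ℝ) := sum_norm_charSum_pow hyp
      _ ≤ p * (8 ^ n * (y : ℝ) ^ (n + 1) * (1 + Real.log y) ^ (n ^ 2)) :=
          mul_le_mul (by linarith) (multiplicativeEnergy_le n y) (Nat.cast_nonneg _) hp0.le
      _ ≤ p * (8 ^ n * (y : ℝ) ^ (n + 1) * (2 * L) ^ (n ^ 2)) := by gcongr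
      _ = _ := by rw [mul_pow]; ring
  have hR : ∑ χ ∈ S, ‖resonator h X χ‖ ^ 2 ≤ C * P₂ := by
    calc ∑ χ ∈ S, ‖resonator h X χ‖ ^ 2 ≤ ∑ χ, ‖resonator h X χ‖ ^ 2 :=
          sum_le_sum_of_subset_of_nonneg (subset_univ _) fun _ _ _ => by positivity
      _ ≤ p * ∑ v ∈ Icc 1 X, h v ^ 2 := sum_norm_resonator_sq_le h hX
      _ ≤ p * (C * (X * L ^ (n ^ 2 + 2 * n))) := by gcongr
      _ = _ := by ring
  have hHol := sum_mul_pow_mul_pow_le S (f := fun χ => ‖Θ χ‖) (g := fun χ => ‖charSum p y χ‖)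
    (h := fun χ => ‖resonator h X χ‖) (fun _ => norm_nonneg _) (fun _ => norm_nonneg _) n
  have hmix' : c * (p * (N : ℝ) ^ η * X * L ^ (n * (n + 1))) ≤
      ∑ χ ∈ S, ‖Θ χ‖ * ‖charSum p y χ‖ ^ n * ‖resonator h X χ‖ := by
    refine hmix.trans ((norm_sum_le _ _).trans (le_of_eq (sum_congr rfl fun χ _ => ?_)))
    rw [norm_mul, norm_mul, norm_pow, RCLike.norm_conj, mul_assoc]
  set T := ∑ χ ∈ S, ‖Θ χ‖ ^ (2 * (n + 1)) with hT
  have hT0 : 0 ≤ T := sum_nonneg fun _ _ => by positivity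
  have hkey : (c * (p * (N : ℝ) ^ η * X * L ^ (n * (n + 1)))) ^ (2 * (n + 1)) ≤
      T * ((8 ^ n * 2 ^ n ^ 2) * P₁) ^ n * (C * P₂) ^ (n + 1) := by
    refine (pow_le_pow_left₀ (by positivity) hmix' _).trans (hHol.trans ?_)
    gcongr
  have hid : (c * (p * (N : ℝ) ^ η * X * L ^ (n * (n + 1)))) ^ (2 * (n + 1)) =
      c ^ (2 * (n + 1)) * (p * (N : ℝ) ^ ((n + 1) * (1 + 2 * η)) * L ^ n ^ 2) *
        (P₁ ^ n * P₂ ^ (n + 1)) := by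
    rw [hP₁, hP₂, hXdef]
    push_cast
    ring
  have hpos : 0 < P₁ ^ n * P₂ ^ (n + 1) := by positivity
  rw [hid, mul_pow (8 ^ n * 2 ^ n ^ 2) P₁, mul_pow C P₂] at hkey
  rw [div_mul_eq_mul_div, div_le_iff₀ (by positivity)]
  refine le_of_mul_le_mul_right (hkey.trans (le_of_eq ?_)) hpos
  ring

/-- The lengths of the character sums are small powers of `p`. -/
theorem length_bounds {n p N y : ℕ} (hp : 7 ≤ p) (hNdef : N = Nat.nthRoot 2 p)
    (hydef : y = Nat.nthRoot (8 * (n + 1)) p) :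
    1 ≤ N ∧ 1 ≤ y ∧ N ^ 2 ≤ p ∧ p ≤ 4 * N ^ 2 ∧ (y ^ n) ^ 8 ≤ p ∧ y ^ (n + 1) < p ∧
      (N * y ^ n) ^ 8 ≤ p ^ 5 ∧ 2 * (N * y ^ n) ≤ p := by
  have hN : 1 ≤ N := hNdef ▸ (Nat.le_nthRoot_iff (by norm_num)).2 (by rw [one_pow]; omega)
  have hy : 1 ≤ y := hydef ▸ (Nat.le_nthRoot_iff (by omega)).2 (by rw [one_pow]; omega)
  have hNp : N ^ 2 ≤ p := (Nat.le_nthRoot_iff (by norm_num)).1 hNdef.le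
  have hyp : y ^ (8 * (n + 1)) ≤ p := (Nat.le_nthRoot_iff (by omega)).1 hydef.le
  have hyn : (y ^ n) ^ 8 ≤ p := by
    refine le_trans ?_ hyp
    rw [← pow_mul]
    exact Nat.pow_le_pow_right hy (by omega)
  have hX8 : (N * y ^ n) ^ 8 ≤ p ^ 5 := by
    calc (N * y ^ n) ^ 8 = (N ^ 2) ^ 4 * (y ^ n) ^ 8 := by ring
      _ ≤ p ^ 4 * p := Nat.mul_le_mul (Nat.pow_le_pow_left hNp 4) hyn
      _ = _ := by ring
  refine ⟨hN, hy, hNp, ?_, hyn, ?_, hX8, ?_⟩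
  · have h1 : p < (N + 1) ^ 2 := hNdef ▸ Nat.lt_pow_nthRoot_add_one (by norm_num) p
    nlinarith
  · have h1 : (y ^ (n + 1)) ^ 8 ≤ p := by rw [← pow_mul, mul_comm]; exact hyp
    by_contra! h2
    have h3 := (Nat.pow_le_pow_left h2 8).trans h1
    have h4 : p ^ 1 < p ^ 8 := Nat.pow_lt_pow_right (by omega) (by norm_num)
    rw [pow_one] at h4
    exact absurd h3 (not_le.2 h4)
  · refine le_of_pow_le_pow_left₀ (n := 8) (by norm_num) (Nat.zero_le _) ?_
    calc (2 * (N * y ^ n)) ^ 8 = 256 * (N * y ^ n) ^ 8 := by ring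
      _ ≤ p ^ 3 * p ^ 5 :=
        Nat.mul_le_mul ((by norm_num : 256 ≤ 7 ^ 3).trans (Nat.pow_le_pow_left hp 3)) hX8
      _ = _ := by ring

/-- The order of magnitude of the diagonal contribution to the mixed moment. -/
theorem exists_eventually_main_term_ge (n η : ℕ) {Q : ℕ} (hQ : 0 < Q) :
    ∃ c : ℝ, 0 < c ∧ ∀ᶠ p : ℕ in atTop, ∀ N y : ℕ, N = Nat.nthRoot 2 p →
      y = Nat.nthRoot (8 * (n + 1)) p →
      c * ((N : ℝ) ^ η * ((N * y ^ n : ℕ) : ℝ) * Real.log p ^ (n * (n + 1))) ≤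
        Real.exp (-Real.pi) * ((N : ℝ) / 2) ^ η *
        ((∑ m ∈ Icc 1 N with (N : ℝ) / 2 < ((m : ℕ) : ℝ), roughWeight (n + 1) Q m) *
          (∑ a ∈ Icc 1 y, roughWeight (n + 1) Q a) ^ n) := by
  obtain ⟨c₁, hc₁, h₁⟩ := exists_eventually_sum_roughWeight_ge n hQ (m := 2) (by norm_num)
  obtain ⟨c₂, hc₂, h₂⟩ := exists_eventually_sum_roughWeight_ge n hQ (m := 8 * (n + 1)) (by omega)
  refine ⟨Real.exp (-Real.pi) * (1 / 2) ^ η * (c₁ * c₂ ^ n), by positivity, ?_⟩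
  filter_upwards [h₁, h₂] with p h₁ h₂ N y hN hy
  rw [← hN] at h₁
  rw [← hy] at h₂
  have hL := Real.log_natCast_nonneg p
  have h₃ : c₂ * (y * Real.log p ^ n) ≤ ∑ a ∈ Icc 1 y, roughWeight (n + 1) Q a :=
    h₂.trans (sum_le_sum_of_subset_of_nonneg (filter_subset _ _)
      fun _ _ _ => roughWeight_nonneg _ _ _)
  calc _ = Real.exp (-Real.pi) * ((N : ℝ) / 2) ^ η *
        ((c₁ * (N * Real.log p ^ n)) * (c₂ * (y * Real.log p ^ n)) ^ n) := by
        push_cast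
        ring
    _ ≤ _ := by
        gcongr
        exact sum_nonneg fun _ _ => roughWeight_nonneg _ _ _

theorem sum_roughWeight_sq_le_log {n p X : ℕ} (hX : 1 ≤ X) (hXp : X ≤ p)
    (hlog : 1 ≤ Real.log p) :
    ∑ v ∈ Icc 1 X, roughWeight (n + 1) (((n + 1) ^ 2) ^ 4).factorial v ^ 2 ≤
      ((∑' n : ℕ, 1 / (n : ℝ) ^ (3 / 2 : ℝ)) * 2 ^ (n ^ 2 + 2 * n)) *
        (X * Real.log p ^ (n ^ 2 + 2 * n)) := by
  have h := sum_roughWeight_sq_le (Nat.le_add_left 1 n) X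
  rw [show (n + 1) ^ 2 - 1 = n ^ 2 + 2 * n by rw [Nat.sub_eq_iff_eq_add (Nat.one_le_pow 2 (n + 1) (Nat.succ_pos n))]; ring] at h
  refine h.trans ?_
  have hX0 : (0 : ℝ) < X := by exact_mod_cast hX
  have h1 : Real.log X ≤ Real.log p := Real.log_le_log hX0 (by exact_mod_cast hXp)
  have h2 : 1 + Real.log X ≤ 2 * Real.log p := by linarith
  have h3 : 0 ≤ 1 + Real.log X := by
    have := Real.log_natCast_nonneg X
    linarith
  have h4 : 0 ≤ ∑' n : ℕ, 1 / (n : ℝ) ^ (3 / 2 : ℝ) := tsum_nonneg fun _ => by positivity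
  calc _ ≤ (∑' n : ℕ, 1 / (n : ℝ) ^ (3 / 2 : ℝ)) * (X * (2 * Real.log p) ^ (n ^ 2 + 2 * n)) := by
        gcongr
    _ = _ := by rw [mul_pow]; ring

theorem eventually_mul_log_pow_le (K : ℝ) (B : ℕ) :
    ∀ᶠ p : ℕ in atTop, K * Real.log p ^ B ≤ (p : ℝ) ^ (1 / 8 : ℝ) := by
  have h1 : (fun x : ℝ => K * Real.log x ^ B) =o[atTop] fun x : ℝ => x ^ (1 / 8 : ℝ) := by
    have h2 := isLittleO_log_rpow_rpow_atTop (B : ℝ) (show (0 : ℝ) < 1 / 8 by norm_num)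
    simp only [Real.rpow_natCast] at h2
    exact h2.const_mul_left K
  have h3 := (h1.bound one_pos)
  have h4 := tendsto_natCast_atTop_atTop (R := ℝ) |>.eventually h3
  filter_upwards [h4] with p hp
  rw [one_mul, Real.norm_eq_abs,
    Real.norm_of_nonneg (Real.rpow_nonneg (Nat.cast_nonneg p) _)] at hp
  exact (le_abs_self _).trans hp

theorem norm_charSum_le {p : ℕ} (y : ℕ) (χ : DirichletCharacter ℂ p) :
    ‖charSum p y χ‖ ≤ y := by
  calc ‖charSum p y χ‖ ≤ ∑ _a ∈ Icc 1 y, (1 : ℝ) :=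
        norm_sum_le_of_le _ fun a _ => χ.norm_le_one _
    _ = y := by simp

theorem norm_resonator_le {p : ℕ} {h : ℕ → ℝ} (hh : ∀ v, 0 ≤ h v) (X : ℕ)
    (χ : DirichletCharacter ℂ p) : ‖resonator h X χ‖ ≤ ∑ v ∈ Icc 1 X, h v :=
  norm_sum_le_of_le _ fun v _ => by
    rw [norm_mul, Complex.norm_real, Real.norm_of_nonneg (hh v)]
    exact mul_le_of_le_one_right (hh v) (χ.norm_le_one _)

theorem tendsto_log_natCast_atTop : Tendsto (fun p : ℕ => Real.log p) atTop atTop :=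
  Real.tendsto_log_atTop.comp tendsto_natCast_atTop_atTop

/-- For even characters all solutions of the congruences contribute nonnegatively to the mixed
moment, and only the principal character has to be removed. -/
theorem exists_eventually_evenThetaMoment_ge (n : ℕ) :
    ∃ c : ℝ, 0 < c ∧ ∀ᶠ p : ℕ in atTop, ∀ [Fact p.Prime],
      c * (p * (Nat.nthRoot 2 p : ℝ) ^ ((n + 1) * (1 + 2 * 0)) * Real.log p ^ n ^ 2) ≤
        evenThetaMoment (n + 1) p := by
  set Q := (((n + 1) ^ 2) ^ 4).factorial with hQ
  have hQ0 : 0 < Q := Nat.factorial_pos _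
  obtain ⟨c, hc, hmain⟩ := exists_eventually_main_term_ge n 0 hQ0
  set C₀ := ∑' m : ℕ, 1 / ((m + 1 : ℕ) : ℝ) ^ (3 / 2 : ℝ)
  have hsum : Summable fun n : ℕ => 1 / (n : ℝ) ^ (3 / 2 : ℝ) :=
    Real.summable_one_div_nat_rpow.2 (by norm_num)
  have hC₀ : 0 ≤ C₀ := tsum_nonneg fun _ => by positivity
  set C := (∑' n : ℕ, 1 / (n : ℝ) ^ (3 / 2 : ℝ)) * 2 ^ (n ^ 2 + 2 * n)
  have hC : 0 < C := by
    have := hsum.tsum_pos (fun n => by positivity) 1 (by norm_num)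
    positivity
  refine ⟨(c / 8) ^ (2 * (n + 1)) / ((8 ^ n * 2 ^ n ^ 2) ^ n * C ^ (n + 1)), by positivity, ?_⟩
  filter_upwards [hmain, tendsto_log_natCast_atTop.eventually_ge_atTop 1,
    eventually_ge_atTop 7, eventually_mul_log_pow_le (8 * (C₀ * C) / c) (n ^ 2 + 2 * n)]
    with p hmain hlog hp hgrowth _
  obtain ⟨hN, hy, hNp, -, hyn, hyp, hX8, h2X⟩ := length_bounds (n := n) hp rfl rfl
  have hmain := hmain _ _ rfl rfl
  set N := Nat.nthRoot 2 p
  set y := Nat.nthRoot (8 * (n + 1)) p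
  set X := N * y ^ n
  set L := Real.log p
  have hp0 : (0 : ℝ) < p := by exact_mod_cast (by omega : 0 < p)
  have hp7 : (7 : ℝ) ≤ p := by exact_mod_cast hp
  have hX1 : 1 ≤ X := Nat.mul_pos hN (pow_pos hy n)
  have hX1' : (1 : ℝ) ≤ X := by exact_mod_cast hX1
  have hh := roughWeight_nonneg (n + 1) Q
  have hsq := sum_roughWeight_sq_le_log (n := n) hX1 (by omega : X ≤ p) hlog
  rw [evenThetaMoment_eq]
  refine moment_ge_of_mixed_moment_ge (n := n) (η := 0) (h := roughWeight (n + 1) Q)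
    (c := c / 8) (C := C) (by positivity) hC hlog hN hy hyp (by omega) hsq ?_
  have hmix := sum_thetaSeries_mul_resonator (p := p) 0 (ε := 1) (Or.inl rfl) hh n y
    (X := X) (by omega)
  have hterm := main_term_le_tsum (p := p) 0 (n + 1) Q n y hNp
  have hneg : 0 ≤ ∑' m : ℕ, thetaWeight p 0 (m + 1) *
      congruenceSum (roughWeight (n + 1) Q) n y X (-((m + 1 : ℕ) : ZMod p)) :=
    tsum_nonneg fun m => mul_nonneg (thetaWeight_nonneg _ _ _) (congruenceSum_nonneg hh _ _ _ _)
  -- The principal character contributes less than the diagonal.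
  have hprin : ‖thetaSeries p 0 1 (1 : DirichletCharacter ℂ p) *
      (charSum p y (1 : DirichletCharacter ℂ p) ^ n *
        conj (resonator (roughWeight (n + 1) Q) X (1 : DirichletCharacter ℂ p)))‖ ≤
      c / 8 * (p * (X * L ^ (n * (n + 1)))) := by
    have h1 : (y : ℝ) ^ n ≤ (p : ℝ) ^ (1 / 8 : ℝ) := by
      calc (y : ℝ) ^ n = (((y : ℝ) ^ n) ^ 8) ^ (1 / 8 : ℝ) := by
            rw [← Real.rpow_natCast ((y : ℝ) ^ n) 8, ← Real.rpow_mul (by positivity)]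
            norm_num
        _ ≤ _ := Real.rpow_le_rpow (by positivity) (by exact_mod_cast hyn) (by norm_num)
    have h2 : ∑ v ∈ Icc 1 X, roughWeight (n + 1) Q v ≤ C * (X * L ^ (n ^ 2 + 2 * n)) :=
      (sum_le_sum fun v _ => roughWeight_le_sq (Nat.le_add_left 1 n) Q v).trans hsq
    rw [norm_mul, norm_mul, norm_pow, RCLike.norm_conj]
    calc _ ≤ ((p : ℝ) ^ (3 / 4 : ℝ) * C₀) * ((p : ℝ) ^ (1 / 8 : ℝ) *
          (C * (X * L ^ (n ^ 2 + 2 * n)))) := by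
          refine mul_le_mul ((norm_thetaSeries_le p 0 1).trans (tsum_thetaWeight_even_le p))
            (mul_le_mul ?_ ((norm_resonator_le hh X 1).trans h2) (norm_nonneg _)
              (by positivity)) (by positivity) (by positivity)
          exact (pow_le_pow_left₀ (norm_nonneg _) (norm_charSum_le y 1) n).trans h1
      _ = c / 8 * ((p : ℝ) ^ (3 / 4 : ℝ) * (p : ℝ) ^ (1 / 8 : ℝ) *
            (8 * (C₀ * C) / c * L ^ (n ^ 2 + 2 * n)) * X) := by
          field_simp
      _ ≤ c / 8 * ((p : ℝ) ^ (3 / 4 : ℝ) * (p : ℝ) ^ (1 / 8 : ℝ) *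
            (p : ℝ) ^ (1 / 8 : ℝ) * X) := by gcongr
      _ = c / 8 * (p * X) := by
          rw [← Real.rpow_add hp0, ← Real.rpow_add hp0]
          norm_num
      _ ≤ _ := by
          gcongr
          exact le_mul_of_one_le_right (by positivity) (one_le_pow₀ hlog)
  have hsplit := add_sum_erase ({χ | χ (-1) = ((1 : ℝ) : ℂ)} : Finset (DirichletCharacter ℂ p))
    (fun χ => thetaSeries p 0 1 χ *
      (charSum p y χ ^ n * conj (resonator (roughWeight (n + 1) Q) X χ)))
    (a := 1) (by simp [MulChar.one_apply])
  rw [hmix] at hsplit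
  rw [← eq_sub_iff_add_eq'] at hsplit
  rw [hsplit]
  refine le_trans ?_ (norm_sub_norm_le _ _)
  rw [Complex.norm_real]
  refine le_trans ?_ (sub_le_sub_left hprin _)
  refine le_trans ?_ (sub_le_sub_right (le_abs_self _) _)
  have h3 := hmain.trans hterm
  rw [pow_zero, one_mul] at h3 ⊢
  set M := (X : ℝ) * L ^ (n * (n + 1))
  have hM : 0 ≤ M := by positivity
  have h4 : (p : ℝ) / 4 * (c * M) ≤ (p - 1) / 2 * (∑' m : ℕ, thetaWeight p 0 (m + 1) *
      congruenceSum (roughWeight (n + 1) Q) n y X ((m + 1 : ℕ) : ZMod p) +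
      1 * ∑' m : ℕ, thetaWeight p 0 (m + 1) *
        congruenceSum (roughWeight (n + 1) Q) n y X (-((m + 1 : ℕ) : ZMod p))) :=
    mul_le_mul (by linarith) (by linarith) (by positivity) (by linarith)
  calc c / 8 * (p * 1 * X * L ^ (n * (n + 1))) = p / 4 * (c * M) - c / 8 * (p * M) := by
        simp only [M]; ring
    _ ≤ _ := by simpa using h4

/-- For odd characters the solutions with the sign `-1` count negatively; their contribution is
bounded, while the diagonal grows with `N`. -/
theorem exists_eventually_oddThetaMoment_ge (n : ℕ) :
    ∃ c : ℝ, 0 < c ∧ ∀ᶠ p : ℕ in atTop, ∀ [Fact p.Prime],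
      c * (p * (Nat.nthRoot 2 p : ℝ) ^ ((n + 1) * (1 + 2 * 1)) * Real.log p ^ n ^ 2) ≤
        oddThetaMoment (n + 1) p := by
  set Q := (((n + 1) ^ 2) ^ 4).factorial with hQ
  have hQ0 : 0 < Q := Nat.factorial_pos _
  obtain ⟨c, hc, hmain⟩ := exists_eventually_main_term_ge n 1 hQ0
  set C₀ := (5040 * 256 * 8) * ∑' m : ℕ, 1 / ((m + 1 : ℕ) : ℝ) ^ 2
  have hsum : Summable fun n : ℕ => 1 / (n : ℝ) ^ (3 / 2 : ℝ) :=
    Real.summable_one_div_nat_rpow.2 (by norm_num)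
  set C := (∑' n : ℕ, 1 / (n : ℝ) ^ (3 / 2 : ℝ)) * 2 ^ (n ^ 2 + 2 * n)
  have hC : 0 < C := by
    have := hsum.tsum_pos (fun n => by positivity) 1 (by norm_num)
    positivity
  refine ⟨(c / 8) ^ (2 * (n + 1)) / ((8 ^ n * 2 ^ n ^ 2) ^ n * C ^ (n + 1)), by positivity, ?_⟩
  filter_upwards [hmain, tendsto_log_natCast_atTop.eventually_ge_atTop 1,
    eventually_ge_atTop 7, eventually_ge_atTop (⌈2 * C₀ / c⌉₊ ^ 2)]
    with p hmain hlog hp hgrowth _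
  obtain ⟨hN, hy, hNp, -, hyn, hyp, hX8, h2X⟩ := length_bounds (n := n) hp rfl rfl
  have hmain := hmain _ _ rfl rfl
  have hNC : 2 * C₀ / c ≤ Nat.nthRoot 2 p :=
    (Nat.le_ceil _).trans (by exact_mod_cast (Nat.le_nthRoot_iff (by norm_num)).2 hgrowth)
  set N := Nat.nthRoot 2 p
  set y := Nat.nthRoot (8 * (n + 1)) p
  set X := N * y ^ n
  set L := Real.log p
  have hp7 : (7 : ℝ) ≤ p := by exact_mod_cast hp
  have hX1 : 1 ≤ X := Nat.mul_pos hN (pow_pos hy n)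
  have hX1' : (1 : ℝ) ≤ X := by exact_mod_cast hX1
  have hN1' : (1 : ℝ) ≤ N := by exact_mod_cast hN
  have hh := roughWeight_nonneg (n + 1) Q
  have hsq := sum_roughWeight_sq_le_log (n := n) hX1 (by omega : X ≤ p) hlog
  rw [oddThetaMoment_eq]
  refine moment_ge_of_mixed_moment_ge (n := n) (η := 1) (h := roughWeight (n + 1) Q)
    (c := c / 8) (C := C) (by positivity) hC hlog hN hy hyp (by omega) hsq ?_
  have hmix := sum_thetaSeries_mul_resonator (p := p) 1 (ε := -1) (Or.inr rfl) hh n y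
    (X := X) (by omega)
  have hterm := hmain.trans (main_term_le_tsum (p := p) 1 (n + 1) Q n y hNp)
  have herr := tsum_odd_error_le (p := p) hh (fun v hv => roughWeight_le_self (n + 1) hv)
    hyn hX8 h2X
  rw [hmix, Complex.norm_real]
  refine le_trans ?_ (le_abs_self _)
  rw [pow_one] at hterm ⊢
  set M := (N : ℝ) * X * L ^ (n * (n + 1)) with hM
  have hM0 : 0 ≤ M := by positivity
  have hMN : (N : ℝ) ≤ M := by
    rw [hM, mul_assoc]
    exact le_mul_of_one_le_right (by positivity)
      (one_le_mul_of_one_le_of_one_le hX1' (one_le_pow₀ hlog))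
  have h1 : C₀ ≤ c * M / 2 := by
    rw [div_le_iff₀ hc] at hNC
    nlinarith
  calc c / 8 * (p * N * X * L ^ (n * (n + 1))) = p / 4 * (c * M / 2) := by
        rw [hM]; ring
    _ ≤ _ := mul_le_mul (by linarith) (by linarith) (by positivity) (by linarith)

/-! ### Passage to all primes -/

/-- A bound that holds for all large arguments, between a positive and a nonnegative function,
holds everywhere with a smaller constant. -/
theorem exists_const_of_eventually {P : ℕ → Prop} {f g : ℕ → ℝ} (hf : ∀ p, P p → 0 < f p)
    (hg : ∀ p, 0 ≤ g p)
    (h : ∃ c : ℝ, 0 < c ∧ ∀ᶠ p : ℕ in atTop, P p → c * g p ≤ f p) :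
    ∃ c : ℝ, 0 < c ∧ ∀ p, P p → c * g p ≤ f p := by
  obtain ⟨c, hc, hev⟩ := h
  obtain ⟨p₀, hp₀⟩ := eventually_atTop.1 hev
  have hfin : ∀ m : ℕ, ∃ c : ℝ, 0 < c ∧ ∀ p < m, P p → c * g p ≤ f p := by
    intro m
    induction m with
    | zero => exact ⟨1, one_pos, fun p hp => absurd hp (Nat.not_lt_zero p)⟩
    | succ m ih =>
      obtain ⟨d, hd, hdm⟩ := ih
      by_cases hm : P m
      · have hfm := hf m hm
        have hgm := hg m
        refine ⟨min d (f m / (g m + 1)), lt_min hd (by positivity), fun p hp hPp => ?_⟩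
        rcases Nat.lt_succ_iff_lt_or_eq.1 hp with hlt | rfl
        · exact (mul_le_mul_of_nonneg_right (min_le_left _ _) (hg p)).trans (hdm p hlt hPp)
        · refine (mul_le_mul_of_nonneg_right (min_le_right _ _) (hg p)).trans ?_
          rw [div_mul_eq_mul_div, div_le_iff₀ (by positivity)]
          nlinarith
      · refine ⟨d, hd, fun p hp hPp => ?_⟩
        rcases Nat.lt_succ_iff_lt_or_eq.1 hp with hlt | rfl
        · exact hdm p hlt hPp
        · exact absurd hPp hm
  obtain ⟨d, hd, hdp⟩ := hfin p₀
  refine ⟨min c d, lt_min hc hd, fun p hPp => ?_⟩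
  rcases lt_or_ge p p₀ with hlt | hge
  · exact (mul_le_mul_of_nonneg_right (min_le_right _ _) (hg p)).trans (hdp p hlt hPp)
  · exact (mul_le_mul_of_nonneg_right (min_le_left _ _) (hg p)).trans (hp₀ p hge hPp)

/-- The length `⌊√p⌋` is at least `√p / 2`. -/
theorem rpow_one_add_half_le {p : ℕ} (hp : 7 ≤ p) (e : ℕ) :
    (p : ℝ) ^ (1 + (e : ℝ) / 2) ≤ 2 ^ e * (p * (Nat.nthRoot 2 p : ℝ) ^ e) := by
  obtain ⟨-, -, -, hpN, -⟩ := length_bounds (n := 0) hp rfl rfl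
  have hp0 : (0 : ℝ) < p := by exact_mod_cast (by omega : 0 < p)
  have h1 : √(p : ℝ) ≤ 2 * Nat.nthRoot 2 p := by
    refine Real.sqrt_le_iff.2 ⟨by positivity, ?_⟩
    rw [mul_pow]
    norm_num
    exact_mod_cast hpN
  calc (p : ℝ) ^ (1 + (e : ℝ) / 2) = p * √(p : ℝ) ^ e := by
        rw [Real.rpow_add hp0, Real.rpow_one, Real.sqrt_eq_rpow, ← Real.rpow_natCast,
          ← Real.rpow_mul hp0.le]
        congr 2
        ring
    _ ≤ p * (2 * Nat.nthRoot 2 p) ^ e := by gcongr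
    _ = _ := by rw [mul_pow]; ring

theorem exists_eventually_rpow_le {f : ℕ → ℝ} (e B : ℕ)
    (h : ∃ c : ℝ, 0 < c ∧ ∀ᶠ p : ℕ in atTop, ∀ [Fact p.Prime],
      c * (p * (Nat.nthRoot 2 p : ℝ) ^ e * Real.log p ^ B) ≤ f p) :
    ∃ c : ℝ, 0 < c ∧ ∀ᶠ p : ℕ in atTop, p.Prime →
      c * ((p : ℝ) ^ (1 + (e : ℝ) / 2) * Real.log p ^ B) ≤ f p := by
  obtain ⟨c, hc, h⟩ := h
  refine ⟨c / 2 ^ e, by positivity, ?_⟩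
  filter_upwards [h, eventually_ge_atTop 7] with p hp hp7 hprime
  have : Fact p.Prime := ⟨hprime⟩
  refine le_trans ?_ hp
  have h1 := rpow_one_add_half_le hp7 e
  have h2 := Real.log_natCast_nonneg p
  calc _ ≤ c / 2 ^ e * ((2 ^ e * (p * (Nat.nthRoot 2 p : ℝ) ^ e)) * Real.log p ^ B) := by gcongr
    _ = _ := by field_simp

theorem theorem1p1 (k : ℕ) (hk : 1 ≤ k) :
    ∃ c : ℝ, 0 < c ∧
      (∀ (p : ℕ) [Fact p.Prime], 5 ≤ p →
        c * ((p : ℝ) ^ (1 + (k : ℝ) / 2) * Real.log p ^ ((k - 1) ^ 2)) ≤ evenThetaMoment k p) ∧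
      (∀ (p : ℕ) [Fact p.Prime], 3 ≤ p →
        c * ((p : ℝ) ^ (1 + 3 * (k : ℝ) / 2) * Real.log p ^ ((k - 1) ^ 2)) ≤ oddThetaMoment k p) := by
  obtain ⟨n, rfl⟩ : ∃ n, k = n + 1 := ⟨k - 1, by omega⟩
  have hnonneg : ∀ (e : ℝ) (p : ℕ), 0 ≤ (p : ℝ) ^ e * Real.log p ^ n ^ 2 := fun e p => by
    have := Real.log_natCast_nonneg p
    positivity
  obtain ⟨c₁, hc₁, h₁⟩ := exists_const_of_eventually (P := fun p => p.Prime ∧ 5 ≤ p)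
    (fun p hp => haveI : Fact p.Prime := ⟨hp.1⟩; evenThetaMoment_pos (n + 1) hp.2)
    (fun p => hnonneg (1 + (((n + 1) * (1 + 2 * 0) : ℕ) : ℝ) / 2) p)
    ((exists_eventually_rpow_le _ _ (exists_eventually_evenThetaMoment_ge n)).imp
      fun c hc => ⟨hc.1, hc.2.mono fun p hp hP => hp hP.1⟩)
  obtain ⟨c₂, hc₂, h₂⟩ := exists_const_of_eventually (P := fun p => p.Prime ∧ 3 ≤ p)
    (fun p hp => haveI : Fact p.Prime := ⟨hp.1⟩; oddThetaMoment_pos (n + 1) hp.2)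
    (fun p => hnonneg (1 + (((n + 1) * (1 + 2 * 1) : ℕ) : ℝ) / 2) p)
    ((exists_eventually_rpow_le _ _ (exists_eventually_oddThetaMoment_ge n)).imp
      fun c hc => ⟨hc.1, hc.2.mono fun p hp hP => hp hP.1⟩)
  refine ⟨min c₁ c₂, lt_min hc₁ hc₂, fun p hprime hp => ?_, fun p hprime hp => ?_⟩
  · refine le_trans ?_ (h₁ p ⟨hprime.out, hp⟩)
    rw [Nat.add_sub_cancel,
      show 1 + ((n + 1 : ℕ) : ℝ) / 2 = 1 + (((n + 1) * (1 + 2 * 0) : ℕ) : ℝ) / 2 by simp]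
    exact mul_le_mul_of_nonneg_right (min_le_left _ _) (hnonneg _ p)
  · refine le_trans ?_ (h₂ p ⟨hprime.out, hp⟩)
    rw [Nat.add_sub_cancel,
      show 1 + 3 * ((n + 1 : ℕ) : ℝ) / 2 = 1 + (((n + 1) * (1 + 2 * 1) : ℕ) : ℝ) / 2 by
        push_cast; ring]
    exact mul_le_mul_of_nonneg_right (min_le_right _ _) (hnonneg _ p)
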